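/- Conventions. For a bounded domain $E\subset\mathbb C^n$, $K(z,w)$ denotes its Bergman kernel, i.e. the integral kernel of the orthogonal projection of $L^2(E)$ (Lebesgue measure) onto its subspace of holomorphic functions. A reflection is an element of finite order of $U(n)$ whose fixed-point set is a hyperplane, and a finite unitary reflection group is a finite subgroup of $U(n)$ generated by reflections. For such a group $G$: - $\mathcal R_G$ is the set of reflecting hyperplanes, i.e. of the fixed-point sets of the reflections in $G$; $G$ acts on it by $g.Y=\{g.v : v\in Y\}$. - For $Y\in\mathcal R_G$, $G_Y=\{g\in G : g.v=v\ \ \forall v\in Y\}$, $m_Y=|G_Y|$, and $e_Y$ is a chosen unit vector orthogonal to $Y$. For $\mathcal S\subseteq\mathcal R_G$, $G_{\mathcal S}$ is the subgroup generated by $\bigcup_{Y\in\mathcal S}G_Y$. - $J_G(z)=\prod_{Y\in\mathcal R_G}\langle z,e_Y\rangle^{m_Y-1}$, where $\langle\cdot,\cdot\rangle$ is the standard Hermitian product (so $|J_G|$ does not depend on the choice of the $e_Y$). - A bounded $G$-invariant domain $E$ is good if for every $Y\in\mathcal R_G$ the set $Y\cap E$ is connected and $Y\cap bE$ is the topological boundary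 of $Y\cap E$ as a subset of $Y$. - For a $G$-invariant bounded domain $E$ and $p\in(1,\infty)$, $$K_G(z,w)=\frac1{|G|}\sum_{g\in G}K(z,g.w)\,\overline{\det g},\qquad K_{G,p}(z,w)=|J_G(z)|^{\frac2p-1}K_G(z,w)|J_G(w)|^{1-\frac2p}.$$ ($K_G(z,w)=0$ whenever $J_G(z)=0$ or $J_G(w)=0$; at such points $K_{G,p}(z,w)$ is understood to be $0$.) A holomorphic function $f$ on a domain $\Omega$ can be analytically continued past a boundary point $q\in b\Omega$ if there is an open ball $B$ centered at $q$ such that $f$ extends to a holomorphic function on $\Omega\cup B$. Theorem. Let $G\subseteq U(2)$ be a finite unitary reflection group and let $E\subseteq\mathbb C^2$ be a good bounded $G$-invariant domain containing the origin. Assume that (i) the holomorphic function $(z,\overline w)\mapsto K(z,w)$ on $\widetilde E=\{(z,\overline w) : z,w\in E\}\subseteq\mathbb C^2\times\mathbb C^2$ can be analytically continued past every boundary point $(z,\overline w)$ of $\widetilde E$ with $z\neq w$; (ii) there are two $G$-invariant sets $\mathcal S_1,\mathcal S_2\subseteq\mathcal R_G$ such that $\mathcal R_G=\mathcal S_1\cup\mathcal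 S_2$, $\mathcal S_1\cap\mathcal S_2=\emptyset$, and $\mathcal R_{G_j}=\mathcal S_j$ for $j=1,2$, where $G_j=G_{\mathcal S_j}$. Then for every $p\in(1,\infty)$ there is a constant $C>0$ such that for all $z,w\in E$ $$|K_{G,p}(z,w)|\le C\,\frac1{|G|}\sum_{g\in G}\Big(|K_{G_1,p}(g.z,w)|+|K_{G_2,p}(g.z,w)|+1\Big),$$ where $K_{G_j,p}$ is defined as above with the group $G_j$ in place of $G$. -/

import Mathlib

open MeasureTheory Metric Set Filter Topology
open scoped ComplexConjugate ENNReal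

namespace ReflBergman

/-- The space `ℂⁿ` with its Euclidean norm and standard Hermitian product. -/
abbrev Cn (n : ℕ) : Type := EuclideanSpace ℂ (Fin n)

/-- `f` represents an element of the Bergman space `A²(E) = L²(E) ∩ 𝒪(E)`. -/
structure IsBergman {n : ℕ} (E : Set (Cn n)) (f : Cn n → ℂ) : Prop where
  holo : DifferentiableOn ℂ f E
  memLp : MemLp f 2 (volume.restrict E)

/-- `K` is the Bergman kernel of `E`, i.e. the reproducing kernel of `A²(E)`, equivalently the
integral kernel of the orthogonal projection `L²(E) → A²(E)`: each `K(·, w)` lies in `A²(E)` and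
`f(w) = ⟨f, K(·, w)⟩` for all `f ∈ A²(E)`. -/
structure IsBergmanKernel {n : ℕ} (E : Set (Cn n)) (K : Cn n → Cn n → ℂ) : Prop where
  mem : ∀ w ∈ E, IsBergman E (fun z => K z w)
  reproducing : ∀ w ∈ E, ∀ f : Cn n → ℂ, IsBergman E f →
    ∫ z in E, f z * conj (K z w) = f w

theorem IsBergman.sub {n : ℕ} {E : Set (Cn n)} {f g : Cn n → ℂ} (hf : IsBergman E f)
    (hg : IsBergman E g) : IsBergman E (f - g) :=
  ⟨hf.holo.sub hg.holo, hf.memLp.sub hg.memLp⟩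

/-- Mean value property on Euclidean balls. -/
theorem integral_closedBall_of_holo {n : ℕ} {E : Set (Cn n)} {f : Cn n → ℂ}
    (hf : DifferentiableOn ℂ f E) {w : Cn n} {r : ℝ} (hr : closedBall w r ⊆ E) :
    ∫ v in closedBall (0 : Cn n) r, f (w + v) = (volume.real (closedBall (0 : Cn n) r)) • f w := by
  have hmem : ∀ (θ : ℝ) (v : Cn n), v ∈ closedBall (0 : Cn n) r →
      w + Complex.exp (θ * Complex.I) • v ∈ E := by
    intro θ v hv
    apply hr
    simpa [mem_closedBall, dist_eq_norm, norm_smul, Complex.norm_exp_ofReal_mul_I] using hv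
  have hrot : ∀ θ : ℝ, ∫ v in closedBall (0 : Cn n) r, f (w + Complex.exp (θ * Complex.I) • v)
      = ∫ v in closedBall (0 : Cn n) r, f (w + v) := by
    intro θ
    let e : Cn n ≃ₗᵢ[ℝ] Cn n :=
      { toFun := fun v => Complex.exp (θ * Complex.I) • v
        invFun := fun v => (Complex.exp (θ * Complex.I))⁻¹ • v
        map_add' := fun a b => smul_add _ _ _
        map_smul' := fun c a => smul_comm _ _ _
        left_inv := fun v => by simp [smul_smul, Complex.exp_ne_zero]
        right_inv := fun v => by simp [smul_smul, Complex.exp_ne_zero]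
        norm_map' := fun v => by
          show ‖Complex.exp (θ * Complex.I) • v‖ = ‖v‖
          simp [norm_smul, Complex.norm_exp_ofReal_mul_I] }
    have h := (LinearIsometryEquiv.measurePreserving e).setIntegral_preimage_emb
      e.toHomeomorph.measurableEmbedding (fun v => f (w + v)) (closedBall (0 : Cn n) r)
    have hpre : e ⁻¹' closedBall (0 : Cn n) r = closedBall (0 : Cn n) r := by
      ext v; simp
    rw [hpre] at h
    exact h
  have hcirc : ∀ v ∈ closedBall (0 : Cn n) r,
      ∫ θ in (0 : ℝ)..2 * Real.pi, f (w + Complex.exp (θ * Complex.I) • v)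
        = (2 * Real.pi) • f w := by
    intro v hv
    have hd : DifferentiableOn ℂ (fun ζ : ℂ => f (w + ζ • v)) (closedBall 0 1) := by
      refine hf.comp (by fun_prop) ?_
      intro ζ hζ
      apply hr
      have h1 : ‖ζ‖ ≤ 1 := by simpa using hζ
      have h2 : ‖v‖ ≤ r := by simpa using hv
      have : ‖ζ‖ * ‖v‖ ≤ r := (mul_le_of_le_one_left (norm_nonneg _) h1).trans h2
      simpa [mem_closedBall, dist_eq_norm, norm_smul] using this
    have hdc : DiffContOnCl ℂ (fun ζ : ℂ => f (w + ζ • v)) (ball 0 |(1:ℝ)|) := by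
      refine DifferentiableOn.diffContOnCl ?_
      refine hd.mono ?_
      simpa using closure_ball_subset_closedBall
    have h := hdc.circleAverage
    rw [Real.circleAverage_def] at h
    simp only [circleMap, zero_add, Complex.ofReal_one, one_mul, zero_smul, add_zero] at h
    rw [← h, smul_smul, mul_inv_cancel₀ (by positivity), one_smul]
  have hswap : ∫ θ in (0 : ℝ)..2 * Real.pi, ∫ v in closedBall (0 : Cn n) r,
      f (w + Complex.exp (θ * Complex.I) • v)
      = ∫ v in closedBall (0 : Cn n) r, ∫ θ in (0 : ℝ)..2 * Real.pi,
      f (w + Complex.exp (θ * Complex.I) • v) := by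
    apply MeasureTheory.intervalIntegral_integral_swap
    rw [Measure.prod_restrict]
    have hc : ContinuousOn (Function.uncurry fun (θ : ℝ) (v : Cn n) =>
        f (w + Complex.exp (θ * Complex.I) • v))
        (Set.uIcc 0 (2 * Real.pi) ×ˢ closedBall (0 : Cn n) r) := by
      refine hf.continuousOn.comp (f := fun x : ℝ × Cn n => w + Complex.exp (x.1 * Complex.I) • x.2)
        (by fun_prop) ?_
      rintro ⟨θ, v⟩ ⟨_, hv⟩
      exact hmem θ v hv
    have := hc.integrableOn_compact (μ := (volume : Measure ℝ).prod (volume : Measure (Cn n)))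
      (isCompact_uIcc.prod (isCompact_closedBall _ _))
    exact this.mono_set (Set.prod_mono Set.uIoc_subset_uIcc le_rfl)
  simp_rw [hrot] at hswap
  rw [setIntegral_congr_fun measurableSet_closedBall hcirc] at hswap
  simp only [intervalIntegral.integral_const, sub_zero, setIntegral_const] at hswap
  rw [smul_comm] at hswap
  exact smul_right_injective ℂ (by positivity : (2 * Real.pi) ≠ 0) hswap

theorem IsBergman.norm_apply_le {n : ℕ} (E : Set (Cn n)) {r : ℝ} (hr : 0 < r) :
    ∃ C : ℝ, 0 ≤ C ∧ ∀ w : Cn n, closedBall w r ⊆ E → ∀ f : Cn n → ℂ, IsBergman E f →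
      ‖f w‖ ≤ C * (eLpNorm f 2 (volume.restrict E)).toReal := by
  set V := volume.real (closedBall (0 : Cn n) r) with hV
  have hVpos : 0 < V := by
    rw [hV, Measure.real, ENNReal.toReal_pos_iff]
    exact ⟨measure_closedBall_pos _ _ hr, measure_closedBall_lt_top⟩
  refine ⟨V⁻¹ * V ^ (1 / 2 : ℝ), by positivity, ?_⟩
  intro w hw f hf
  have hmean := integral_closedBall_of_holo hf.holo hw
  have htr : ∫ v in closedBall (0 : Cn n) r, f (w + v) = ∫ z in closedBall w r, f z := by
    have h := (measurePreserving_add_left (volume : Measure (Cn n)) w).setIntegral_preimage_emb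
      (Homeomorph.addLeft w).measurableEmbedding f (closedBall w r)
    rw [← h]
    congr 2
    ext v; simp
  have hvol : volume (closedBall w r) = volume (closedBall (0 : Cn n) r) :=
    Measure.addHaar_closedBall_center _ _ _
  have hsub : volume.restrict (closedBall w r) ≤ volume.restrict E := Measure.restrict_mono_set _ hw
  have hmem : MemLp f 2 (volume.restrict (closedBall w r)) := hf.memLp.mono_measure hsub
  have h1 : ‖∫ z in closedBall w r, f z‖ ≤ (eLpNorm f 1 (volume.restrict (closedBall w r))).toReal := by
    rw [eLpNorm_one_eq_lintegral_enorm]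
    refine (norm_integral_le_lintegral_norm _).trans (le_of_eq ?_)
    simp only [ofReal_norm]
  have h2 := eLpNorm_le_eLpNorm_mul_rpow_measure_univ (μ := volume.restrict (closedBall w r))
    (p := 1) (q := 2) (by norm_num) hmem.1
  have h3 : eLpNorm f 2 (volume.restrict (closedBall w r)) ≤ eLpNorm f 2 (volume.restrict E) :=
    eLpNorm_mono_measure _ hsub
  have h4 : (eLpNorm f 1 (volume.restrict (closedBall w r))).toReal ≤
      (eLpNorm f 2 (volume.restrict E)).toReal * V ^ (1 / 2 : ℝ) := by
    rw [Measure.restrict_apply_univ, hvol] at h2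
    have h5 := h2.trans (mul_le_mul_left h3 _)
    have h6 := ENNReal.toReal_mono (ENNReal.mul_ne_top hf.memLp.2.ne
      (ENNReal.rpow_ne_top_of_nonneg (by norm_num) measure_closedBall_lt_top.ne)) h5
    rw [ENNReal.toReal_mul, ← ENNReal.toReal_rpow] at h6
    refine h6.trans (le_of_eq ?_)
    rw [hV, Measure.real]
    norm_num
  have h7 : V * ‖f w‖ = ‖∫ z in closedBall w r, f z‖ := by
    rw [← htr, hmean, norm_smul, Real.norm_of_nonneg hVpos.le]
  calc ‖f w‖ = V⁻¹ * (V * ‖f w‖) := by field_simp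
    _ ≤ V⁻¹ * ((eLpNorm f 2 (volume.restrict E)).toReal * V ^ (1 / 2 : ℝ)) := by
        rw [h7]; gcongr; exact h1.trans h4
    _ = _ := by ring


theorem IsBergman.exists_limit {n : ℕ} {E : Set (Cn n)} (hE : IsOpen E) (g : ℕ → Cn n → ℂ)
    (hg : ∀ k, IsBergman E (g k))
    (hc : ∀ ε > 0, ∃ N, ∀ k ≥ N, ∀ l ≥ N,
      (eLpNorm (g k - g l) 2 (volume.restrict E)).toReal < ε) :
    ∃ G : Cn n → ℂ, DifferentiableOn ℂ G E ∧ ∀ z ∈ E, Tendsto (fun k => g k z) atTop (𝓝 (G z)) := by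
  have hunif : ∀ r > 0, ∀ ε > 0, ∃ N, ∀ k ≥ N, ∀ l ≥ N, ∀ z, closedBall z r ⊆ E →
      ‖g k z - g l z‖ < ε := by
    intro r hr ε hε
    obtain ⟨C, hC0, hC⟩ := IsBergman.norm_apply_le E hr
    obtain ⟨N, hN⟩ := hc (ε / (C + 1)) (by positivity)
    refine ⟨N, fun k hk l hl z hz => ?_⟩
    have h1 := hC z hz _ ((hg k).sub (hg l))
    have h2 := hN k hk l hl
    rw [lt_div_iff₀ (by positivity)] at h2
    have h3 : (0:ℝ) ≤ (eLpNorm (g k - g l) 2 (volume.restrict E)).toReal := ENNReal.toReal_nonneg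
    simp only [Pi.sub_apply] at h1
    nlinarith
  have hball : ∀ z ∈ E, ∃ r > 0, closedBall z r ⊆ E := fun z hz =>
    nhds_basis_closedBall.mem_iff.1 (hE.mem_nhds hz)
  have hlim : ∀ z ∈ E, ∃ a, Tendsto (fun k => g k z) atTop (𝓝 a) := by
    intro z hz
    obtain ⟨r, hr, hzr⟩ := hball z hz
    apply cauchySeq_tendsto_of_complete
    rw [Metric.cauchySeq_iff]
    intro ε hε
    obtain ⟨N, hN⟩ := hunif r hr ε hε
    exact ⟨N, fun k hk l hl => by simpa [dist_eq_norm] using hN k hk l hl z hzr⟩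
  choose! G hG using hlim
  refine ⟨G, ?_, hG⟩
  intro w hw
  obtain ⟨R, hR, hwR⟩ := hball w hw
  set r := R / 3 with hr
  have hr0 : 0 < r := by positivity
  have hsub : ∀ x ∈ ball w r, ∀ y ∈ ball x r, closedBall y r ⊆ E := by
    intro x hx y hy u hu
    apply hwR
    rw [mem_closedBall] at hu ⊢
    rw [mem_ball] at hx hy
    have := dist_triangle4 u y x w
    linarith
  have hin : ∀ x ∈ ball w r, ball x r ⊆ E := fun x hx y hy =>
    hsub x hx y hy (mem_closedBall_self hr0.le)
  have hinE : ∀ x ∈ ball w r, x ∈ E := fun x hx => hin x hx (mem_ball_self hr0)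
  have hdiff : ∀ k, ∀ x ∈ ball w r, DifferentiableAt ℂ (g k) x := fun k x hx =>
    (hg k).holo.differentiableAt (hE.mem_nhds (hinE x hx))
  have hcau : UniformCauchySeqOn (fun k => fderiv ℂ (g k)) atTop (ball w r) := by
    rw [Metric.uniformCauchySeqOn_iff]
    intro ε hε
    obtain ⟨N, hN⟩ := hunif r hr0 (ε * r / 4) (by positivity)
    refine ⟨N, fun k hk l hl x hx => ?_⟩
    have hd : DifferentiableOn ℂ (g k - g l) (ball x r) :=
      ((hg k).holo.sub (hg l).holo).mono (hin x hx)
    have hm : MapsTo (g k - g l) (ball x r) (closedBall ((g k - g l) x) (ε * r / 2)) := by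
      intro y hy
      have h1 := hN k hk l hl y (hsub x hx y hy)
      have h2 := hN k hk l hl x (hsub x hx x (mem_ball_self hr0))
      rw [mem_closedBall, dist_eq_norm]
      refine (norm_sub_le _ _).trans ?_
      simp only [Pi.sub_apply]
      linarith
    have h := Complex.norm_fderiv_le_div_of_mapsTo_ball hd hm hr0
    rw [fderiv_sub (hdiff k x hx) (hdiff l x hx)] at h
    rw [dist_eq_norm]
    refine h.trans_lt ?_
    rw [div_lt_iff₀ hr0]
    nlinarith [mul_pos hε hr0]
  have hlim' : ∀ x ∈ ball w r, ∃ a, Tendsto (fun k => fderiv ℂ (g k) x) atTop (𝓝 a) := fun x hx =>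
    cauchySeq_tendsto_of_complete (hcau.cauchySeq hx)
  choose! G' hG' using hlim'
  have hu := hcau.tendstoUniformlyOn_of_tendsto hG'
  have := hasFDerivAt_of_tendstoUniformlyOn isOpen_ball hu
    (fun k x hx => (hdiff k x hx).hasFDerivAt) (fun x hx => hG x (hinE x hx)) (mem_ball_self hr0)
  exact this.differentiableAt.differentiableWithinAt

/-- The Bergman space `A²(E)` as a subspace of `L²(E)`. -/
def bergmanSpace {n : ℕ} (E : Set (Cn n)) : Submodule ℂ (Lp ℂ 2 (volume.restrict E)) where
  carrier := {f | ∃ g : Cn n → ℂ, DifferentiableOn ℂ g E ∧ f =ᵐ[volume.restrict E] g}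
  add_mem' := by
    rintro a b ⟨g, hg, hag⟩ ⟨h, hh, hbh⟩
    exact ⟨g + h, hg.add hh, (Lp.coeFn_add a b).trans (hag.add hbh)⟩
  zero_mem' := ⟨0, differentiableOn_const 0, Lp.coeFn_zero _ _ _⟩
  smul_mem' := by
    rintro c a ⟨g, hg, hag⟩
    exact ⟨c • g, hg.const_smul c, (Lp.coeFn_smul c a).trans (hag.const_smul c)⟩

theorem isClosed_bergmanSpace {n : ℕ} {E : Set (Cn n)} (hE : IsOpen E) :
    IsClosed (bergmanSpace E : Set (Lp ℂ 2 (volume.restrict E))) := by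
  apply IsSeqClosed.isClosed
  intro x a hx hxa
  choose g hg hxg using hx
  have hgB : ∀ k, IsBergman E (g k) := fun k => ⟨hg k, (memLp_congr_ae (hxg k)).1 (Lp.memLp (x k))⟩
  obtain ⟨G, hGd, hG⟩ := IsBergman.exists_limit hE g hgB (by
    intro ε hε
    obtain ⟨N, hN⟩ := Metric.cauchySeq_iff.1 hxa.cauchySeq ε hε
    refine ⟨N, fun k hk l hl => ?_⟩
    have h := hN k hk l hl
    rw [Lp.dist_def] at h
    rwa [← eLpNorm_congr_ae ((hxg k).sub (hxg l))])
  refine ⟨G, hGd, ?_⟩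
  obtain ⟨ns, hns, hae⟩ := (tendstoInMeasure_of_tendsto_Lp hxa).exists_seq_tendsto_ae
  have hall : ∀ᵐ z ∂(volume.restrict E), ∀ k, x k z = g k z := ae_all_iff.2 hxg
  filter_upwards [hae, hall, ae_restrict_mem hE.measurableSet] with z h1 h2 h3
  simp only [h2] at h1
  exact tendsto_nhds_unique h1 ((hG z h3).comp hns.tendsto_atTop)

theorem IsBergman.eqOn_of_ae_eq {n : ℕ} {E : Set (Cn n)} (hE : IsOpen E) {f g : Cn n → ℂ}
    (hf : DifferentiableOn ℂ f E) (hg : DifferentiableOn ℂ g E)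
    (h : f =ᵐ[volume.restrict E] g) : EqOn f g E :=
  Measure.eqOn_open_of_ae_eq h hE hf.continuousOn hg.continuousOn

/-- Every open set has a Bergman kernel. -/
theorem exists_isBergmanKernel {n : ℕ} {E : Set (Cn n)} (hE : IsOpen E) :
    ∃ K, IsBergmanKernel E K := by
  have hcompl : CompleteSpace (bergmanSpace E) := (isClosed_bergmanSpace hE).completeSpace_coe
  choose rep hrep hae using fun a : bergmanSpace E => a.2
  have hB : ∀ a, IsBergman E (rep a) := fun a =>
    ⟨hrep a, (memLp_congr_ae (hae a)).1 (Lp.memLp (a : Lp ℂ 2 (volume.restrict E)))⟩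
  have key : ∀ w ∈ E, ∃ k : bergmanSpace E, ∀ a : bergmanSpace E, inner ℂ k a = rep a w := by
    intro w hw
    obtain ⟨r, hr, hwr⟩ := nhds_basis_closedBall.mem_iff.1 (hE.mem_nhds hw)
    obtain ⟨C, hC0, hC⟩ := IsBergman.norm_apply_le E hr
    let ev : bergmanSpace E →ₗ[ℂ] ℂ :=
      { toFun := fun a => rep a w
        map_add' := fun a b =>
          IsBergman.eqOn_of_ae_eq hE (hrep _) ((hrep a).add (hrep b))
            (((hae _).symm.trans (Lp.coeFn_add _ _)).trans ((hae a).add (hae b))) hw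
        map_smul' := fun c a =>
          IsBergman.eqOn_of_ae_eq hE (hrep _) ((hrep a).const_smul c)
            (((hae _).symm.trans (Lp.coeFn_smul _ _)).trans ((hae a).const_smul c)) hw }
    let evc : bergmanSpace E →L[ℂ] ℂ := ev.mkContinuous C (fun a => by
      refine (hC w hwr _ (hB a)).trans (le_of_eq ?_)
      rw [← eLpNorm_congr_ae (hae a)]
      rfl)
    refine ⟨(InnerProductSpace.toDual ℂ (bergmanSpace E)).symm evc, fun a => ?_⟩
    rw [InnerProductSpace.toDual_symm_apply]
    rfl
  choose! k hk using key
  refine ⟨fun z w => rep (k w) z, fun w _ => hB (k w), fun w hw f hf => ?_⟩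
  let a : bergmanSpace E := ⟨hf.memLp.toLp f, f, hf.holo, hf.memLp.coeFn_toLp⟩
  have h1 : rep a w = f w := IsBergman.eqOn_of_ae_eq hE (hrep a) hf.holo
    ((hae a).symm.trans hf.memLp.coeFn_toLp) hw
  rw [← h1, ← hk w hw a, Submodule.coe_inner, L2.inner_def]
  refine integral_congr_ae ?_
  filter_upwards [hae (k w), hf.memLp.coeFn_toLp] with z h2 h3
  rw [h2, h3]
  rfl

/-- The Bergman kernel is unique on `E × E`. -/
theorem IsBergmanKernel.eqOn {n : ℕ} {E : Set (Cn n)} {K L : Cn n → Cn n → ℂ}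
    (hK : IsBergmanKernel E K) (hL : IsBergmanKernel E L) :
    ∀ z ∈ E, ∀ w ∈ E, K z w = L z w := by
  intro z hz w hw
  have h1 := hL.reproducing z hz _ (hK.mem w hw)
  have h2 := hK.reproducing w hw _ (hL.mem z hz)
  have h3 := hL.reproducing w hw _ (hL.mem z hz)
  have h4 := hL.reproducing z hz _ (hL.mem w hw)
  have e1 : K z w = conj (L w z) := by
    rw [← h1, ← h2, ← integral_conj]; congr 1; ext u; simp [mul_comm]
  have e2 : L z w = conj (L w z) := by
    refine h4.symm.trans (Eq.trans ?_ (congrArg conj h3))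
    rw [← integral_conj]; congr 1; ext u; simp [mul_comm]
  rw [e1, e2]

open Classical in
/-- The Bergman kernel `K(z, w)` of `E`. It exists for every open `E`, and its values on `E × E`
are uniquely determined. -/
noncomputable def bergmanKernel {n : ℕ} (E : Set (Cn n)) : Cn n → Cn n → ℂ :=
  if h : ∃ K, IsBergmanKernel E K then h.choose else 0

theorem bergmanKernel_spec {n : ℕ} {E : Set (Cn n)} (hE : IsOpen E) :
    IsBergmanKernel E (bergmanKernel E) := by
  have h := exists_isBergmanKernel hE
  rw [bergmanKernel, dif_pos h]
  exact h.choose_spec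

/-- Componentwise complex conjugation on `ℂⁿ`. -/
def conjVec {n : ℕ} (w : Cn n) : Cn n := WithLp.toLp 2 fun i => conj (w i)

/-- The domain `Ẽ = {(z, w̄) : z, w ∈ E}` in `ℂⁿ × ℂⁿ`. -/
def doubledDomain {n : ℕ} (E : Set (Cn n)) : Set (Cn n × Cn n) :=
  {q | ∃ z ∈ E, ∃ w ∈ E, q = (z, conjVec w)}

/-- The holomorphic Bergman kernel `(z, u) ↦ K(z, ū)`, a function on `Ẽ`. -/
noncomputable def holoBergmanKernel {n : ℕ} (E : Set (Cn n)) (q : Cn n × Cn n) : ℂ :=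
  bergmanKernel E q.1 (conjVec q.2)

/-- The function `f` on `Ω` can be analytically continued past the point `q`: for some open ball
`B` centered at `q`, `f` extends to a holomorphic function on `Ω ∪ B`. -/
def ContinuesPast {X : Type*} [NormedAddCommGroup X] [NormedSpace ℂ X] (Ω : Set X) (f : X → ℂ)
    (q : X) : Prop :=
  ∃ r > 0, ∃ F : X → ℂ, DifferentiableOn ℂ F (Ω ∪ ball q r) ∧ EqOn F f Ω

/-- The unitary group `U(n)`, acting on `ℂⁿ`. -/
abbrev UnitaryMap (n : ℕ) : Type := Cn n ≃ₗᵢ[ℂ] Cn n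

/-- The determinant of a unitary map, i.e. its complex Jacobian `J(g)`. -/
noncomputable def UnitaryMap.det {n : ℕ} (g : UnitaryMap n) : ℂ :=
  LinearMap.det (g.toLinearEquiv : Cn n →ₗ[ℂ] Cn n)

/-- The fixed space `{v : g.v = v}`. -/
def fixedSpace {n : ℕ} (g : UnitaryMap n) : Submodule ℂ (Cn n) where
  carrier := {v | g v = v}
  add_mem' := by
    intro a b ha hb
    change g (a + b) = a + b
    change g a = a at ha
    change g b = b at hb
    rw [map_add, ha, hb]
  zero_mem' := map_zero g
  smul_mem' := by
    intro c a ha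
    change g (c • a) = c • a
    change g a = a at ha
    rw [map_smul, ha]

/-- A (unitary) reflection: an element of finite order whose fixed space is a hyperplane. -/
def IsReflection {n : ℕ} (r : UnitaryMap n) : Prop :=
  IsOfFinOrder r ∧ Module.finrank ℂ (fixedSpace r) + 1 = n

/-- A finite unitary reflection group: a finite subgroup of `U(n)` generated by reflections. -/
def IsReflectionGroup {n : ℕ} (G : Subgroup (UnitaryMap n)) : Prop :=
  Finite G ∧ Subgroup.closure {r | r ∈ G ∧ IsReflection r} = G

/-- The set `ℛ_G` of reflecting hyperplanes of `G`. -/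
def reflectingHyperplanes {n : ℕ} (G : Subgroup (UnitaryMap n)) : Set (Submodule ℂ (Cn n)) :=
  {Y | ∃ r ∈ G, IsReflection r ∧ Y = fixedSpace r}

/-- The subgroup `G_Y = {g ∈ G : g.v = v for all v ∈ Y}`. -/
def pointwiseFixer {n : ℕ} (G : Subgroup (UnitaryMap n)) (Y : Submodule ℂ (Cn n)) :
    Subgroup (UnitaryMap n) where
  carrier := {g | g ∈ G ∧ ∀ v ∈ Y, g v = v}
  mul_mem' := by
    rintro a b ⟨ha, ha'⟩ ⟨hb, hb'⟩
    refine ⟨G.mul_mem ha hb, fun v hv => ?_⟩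
    change a (b v) = v
    rw [hb' v hv, ha' v hv]
  one_mem' := ⟨G.one_mem, fun _ _ => rfl⟩
  inv_mem' := by
    rintro a ⟨ha, ha'⟩
    refine ⟨G.inv_mem ha, fun v hv => ?_⟩
    exact (LinearIsometryEquiv.symm_apply_eq a).2 (ha' v hv).symm

/-- The multiplicity `m_Y = |G_Y|`. -/
noncomputable def reflMultiplicity {n : ℕ} (G : Subgroup (UnitaryMap n)) (Y : Submodule ℂ (Cn n)) : ℕ :=
  Nat.card (pointwiseFixer G Y)

/-- The subgroup `G_𝒮` generated by the `G_Y` with `Y ∈ 𝒮`. -/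
noncomputable def generatedSubgroup {n : ℕ} (G : Subgroup (UnitaryMap n)) (S : Set (Submodule ℂ (Cn n))) :
    Subgroup (UnitaryMap n) :=
  Subgroup.closure (⋃ Y ∈ S, (pointwiseFixer G Y : Set (UnitaryMap n)))

/-- A set of hyperplanes is `G`-invariant: `g.Y ∈ 𝒮` for all `g ∈ G` and `Y ∈ 𝒮`. -/
def IsInvariantFamily {n : ℕ} (G : Subgroup (UnitaryMap n)) (S : Set (Submodule ℂ (Cn n))) :
    Prop :=
  ∀ g ∈ G, ∀ Y ∈ S, Y.map (g.toLinearEquiv : Cn n →ₗ[ℂ] Cn n) ∈ S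

/-- `e` picks a root, i.e. a unit normal vector, of every reflecting hyperplane of `G`. -/
def IsRootChoice {n : ℕ} (G : Subgroup (UnitaryMap n)) (e : Submodule ℂ (Cn n) → Cn n) : Prop :=
  ∀ Y ∈ reflectingHyperplanes G, ‖e Y‖ = 1 ∧ e Y ∈ Yᗮ

/-- The Jacobian polynomial `J_G(z) = ∏_{Y ∈ ℛ_G} ⟨z, e_Y⟩ ^ (m_Y - 1)`, where `⟨·, ·⟩` is linear in
the first variable (Mathlib's `inner` is linear in the second one). -/
noncomputable def jacobianPoly {n : ℕ} (G : Subgroup (UnitaryMap n))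
    (e : Submodule ℂ (Cn n) → Cn n) (z : Cn n) : ℂ :=
  ∏ᶠ Y ∈ reflectingHyperplanes G, (inner ℂ (e Y) z) ^ (reflMultiplicity G Y - 1)

/-- A bounded domain of `ℂⁿ` (open and connected, non-empty) that is invariant under `G`. -/
structure IsBoundedInvariantDomain {n : ℕ} (G : Subgroup (UnitaryMap n)) (E : Set (Cn n)) :
    Prop where
  isOpen : IsOpen E
  isConnected : IsConnected E
  isBounded : Bornology.IsBounded E
  invariant : ∀ g ∈ G, ∀ z ∈ E, g z ∈ E

/-- `E` is good: for every reflecting hyperplane `Y`, the set `Y ∩ E` is connected and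
`Y ∩ bE` is the boundary of `Y ∩ E` relative to `Y`. -/
def IsGood {n : ℕ} (G : Subgroup (UnitaryMap n)) (E : Set (Cn n)) : Prop :=
  ∀ Y ∈ reflectingHyperplanes G, IsConnected ((Y : Set (Cn n)) ∩ E) ∧
    (Y : Set (Cn n)) ∩ frontier E =
      Subtype.val '' frontier (Subtype.val ⁻¹' E : Set (Y : Set (Cn n)))

/-- The averaged kernel `K_G(z, w) = |G|⁻¹ ∑_{g ∈ G} K(z, g.w) conj(J(g))`. -/
noncomputable def averagedKernel {n : ℕ} (E : Set (Cn n)) (G : Subgroup (UnitaryMap n))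
    (z w : Cn n) : ℂ :=
  (1 / (Nat.card G : ℂ)) *
    ∑ᶠ g : G, bergmanKernel E z ((g : UnitaryMap n) w) * conj (UnitaryMap.det (g : UnitaryMap n))

/-- The kernel `K_{G,p}(z, w) = |J_G(z)|^(2/p-1) K_G(z, w) |J_G(w)|^(1-2/p)`. At a zero of `J_G` the
factor with a negative exponent is immaterial, since `K_G` vanishes there; the product is `0`. -/
noncomputable def weightedKernel {n : ℕ} (E : Set (Cn n)) (G : Subgroup (UnitaryMap n))
    (e : Submodule ℂ (Cn n) → Cn n) (p : ℝ) (z w : Cn n) : ℂ :=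
  ((‖jacobianPoly G e z‖ ^ (2 / p - 1) : ℝ) : ℂ) * averagedKernel E G z w *
    ((‖jacobianPoly G e w‖ ^ (1 - 2 / p) : ℝ) : ℂ)

end ReflBergman

open ReflBergman

/-! The estimate is local on the compact set `closure E ×ˢ closure E`. A term `K(z, g.w) conj(det
g)` of the kernel can be singular near `(z₀, w₀)` only if `z₀ = g.w₀` lies on the boundary of `E`. A
sum of regular terms over a finite `T ⊆ G` extends past `(z₀, w₀)`, holomorphically in `z` and
antiholomorphically in `w`. If `T` is stable under left multiplication by the reflections fixing
`z₀` and right multiplication by those fixing `w₀`, the extension is semi-invariant under them. This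
forces divisibility by the Jacobian in each variable (`exists_norm_le_jacobianPoly`), so the sum is
at most `C |J_G(z)| |J_G(w)|` (`exists_norm_partialKernel_le`). Since `|2/p - 1| < 1` for `1 < p <
∞`, this product absorbs both weights.

If all terms are regular at `(z₀, w₀)`, the choice `T = G` shows that the weighted kernel is bounded
there. Otherwise the invariance of `|K_{G,p}|` under `z ↦ g.z` reduces to a boundary point `(w₀,
w₀)`. As `0 ∈ E`, `w₀ ≠ 0`; distinct reflecting lines of `ℂ²` meet only at `0`, so all those through
`w₀` belong to one `𝒮_j`. A nontrivial element fixing `w₀` is a reflection in such a line and lies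
in `G_j`. Hence the terms with `g ∉ G_j` are regular, and their sum is controlled as above with `T =
G \ G_j`. The other terms add up to `|G_j| K_{G_j}`, and `|J_G| / |J_{G_j}|` extends to a positive
continuous function near `w₀` (`exists_norm_weightedKernel_le_generated`). -/

namespace ReflBergman

/-! ### Vanishing, division and identity theorems for holomorphic functions -/

/-- A function that is semi-invariant under a finite set of scalings vanishes to high order. -/
theorem norm_le_pow_of_semiinvariant {Λ : Finset ℂ} {δ : ℝ} (hδ : 0 < δ)
    (k : ℕ) : ∀ (j : ℕ) (h : ℂ → ℂ) (M : ℝ), 1 ≤ j → j + k ≤ Λ.card →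
      DifferentiableOn ℂ h (ball 0 δ) → (∀ ζ ∈ ball (0 : ℂ) δ, ‖h ζ‖ ≤ M) →
      (∀ l ∈ Λ, ∀ ζ ∈ ball (0 : ℂ) δ, ζ ≠ 0 → l ^ j * h (l * ζ) = h ζ) →
      ∀ ζ ∈ ball (0 : ℂ) δ, ‖h ζ‖ ≤ M * (‖ζ‖ / δ) ^ k := by
  induction k with
  | zero =>
    intro j h M _ _ _ hM _ ζ hζ
    simpa using hM ζ hζ
  | succ k ih =>
    intro j h M hj hjk hd hM hinv ζ hζ
    -- `X ^ j = 1` has at most `j` roots, fewer than `Λ` has elements. For this `l`, letting `ζ → 0`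
    -- in the semi-invariance gives `h 0 = 0`.
    obtain ⟨l, hl, hlj⟩ : ∃ l ∈ Λ, l ^ j ≠ 1 := by
      by_contra! hcon
      have hsub : Λ ⊆ (Polynomial.nthRoots j (1 : ℂ)).toFinset := by
        intro l hl
        rw [Multiset.mem_toFinset, Polynomial.mem_nthRoots (by omega)]
        exact hcon l hl
      have := (Finset.card_le_card hsub).trans
        ((Multiset.toFinset_card_le _).trans (Polynomial.card_nthRoots j 1))
      omega
    have hzero : h 0 = 0 := by
      have hc : ContinuousAt h 0 := (hd.differentiableAt (ball_mem_nhds 0 hδ)).continuousAt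
      have hc2 : Tendsto (fun ζ => l ^ j * h (l * ζ) - h ζ) (𝓝[≠] 0) (𝓝 (l ^ j * h 0 - h 0)) := by
        have h1 : Tendsto (fun ζ => h (l * ζ)) (𝓝 0) (𝓝 (h 0)) := by
          have h2 : Tendsto (fun ζ : ℂ => l * ζ) (𝓝 0) (𝓝 0) := by
            have : Continuous (fun ζ : ℂ => l * ζ) := by fun_prop
            simpa using this.tendsto 0
          exact hc.tendsto.comp h2
        exact ((h1.const_mul _).sub hc.tendsto).mono_left nhdsWithin_le_nhds
      have hc3 : Tendsto (fun ζ => l ^ j * h (l * ζ) - h ζ) (𝓝[≠] 0) (𝓝 0) := by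
        refine tendsto_const_nhds.congr' ?_
        filter_upwards [mem_nhdsWithin_of_mem_nhds (ball_mem_nhds 0 hδ), self_mem_nhdsWithin]
          with ζ hζ hne
        rw [hinv l hl ζ hζ hne, sub_self]
      have := tendsto_nhds_unique hc2 hc3
      have h4 : (l ^ j - 1) * h 0 = 0 := by rw [sub_mul, one_mul]; exact this
      exact (mul_eq_zero.1 h4).resolve_left (sub_ne_zero.2 hlj)
    have hmul : ∀ ζ, h ζ = ζ * dslope h 0 ζ := by
      intro ζ
      have := sub_smul_dslope h 0 ζ
      simp only [sub_zero, smul_eq_mul, hzero] at this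
      exact this.symm
    -- Dividing by `ζ` turns the weight `l ^ j` into `l ^ (j + 1)`, and the Schwarz lemma bounds the
    -- quotient by `M / δ`. Because of this division the semi-invariance is demanded only for `ζ ≠
    -- 0`.
    have key := ih (j + 1) (dslope h 0) (M / δ) (by omega) (by omega)
      ((Complex.differentiableOn_dslope (ball_mem_nhds 0 hδ)).2 hd)
      (fun ζ hζ => Complex.norm_dslope_le_div_of_mapsTo_ball hd
        (fun x hx => by rw [hzero]; simpa using hM x hx) hζ)
      (fun l hl ζ hζ hne => by
        have h1 := hinv l hl ζ hζ hne
        rw [hmul ζ, hmul (l * ζ)] at h1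
        apply mul_left_cancel₀ hne
        rw [← h1]; ring) ζ hζ
    rw [hmul ζ, norm_mul]
    calc ‖ζ‖ * ‖dslope h 0 ζ‖ ≤ ‖ζ‖ * (M / δ * (‖ζ‖ / δ) ^ k) := by gcongr
      _ = _ := by rw [pow_succ]; field_simp

/-- A holomorphic function that is locally dominated by a polynomial is divisible by it. -/
theorem exists_eq_eval_mul {U : Set ℂ} (hU : IsOpen U) (d : ℕ) :
    ∀ (P : Polynomial ℂ) (f : ℂ → ℂ), P.natDegree = d → P ≠ 0 → DifferentiableOn ℂ f U →
      (∀ a ∈ U, ∃ C : ℝ, ∀ᶠ ζ in 𝓝 a, ‖f ζ‖ ≤ C * ‖P.eval ζ‖) →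
      ∃ g : ℂ → ℂ, DifferentiableOn ℂ g U ∧ ∀ ζ ∈ U, f ζ = P.eval ζ * g ζ := by
  induction d with
  | zero =>
    intro P f hd hP hf _
    obtain ⟨c, rfl⟩ := Polynomial.natDegree_eq_zero.1 hd
    have hc : c ≠ 0 := by rintro rfl; simp at hP
    refine ⟨fun ζ => f ζ / c, hf.div_const c, fun ζ _ => ?_⟩
    simp only [Polynomial.eval_C]
    field_simp
  | succ d ih =>
    intro P f hd hP hf hloc
    -- Roots in `U` are divided out of `f` and `P` one at a time; once none is left in `U`, the
    -- quotient `f / P` is itself holomorphic.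
    by_cases hroot : ∃ a ∈ U, P.eval a = 0
    · obtain ⟨a, ha, hPa⟩ := hroot
      obtain ⟨Q, rfl⟩ := Polynomial.dvd_iff_isRoot.2 hPa
      have hQ : Q ≠ 0 := right_ne_zero_of_mul hP
      have hdeg : Q.natDegree = d := by
        rw [Polynomial.natDegree_mul (Polynomial.X_sub_C_ne_zero a) hQ,
          Polynomial.natDegree_X_sub_C] at hd
        omega
      have hfa : f a = 0 := by
        obtain ⟨C, hC⟩ := hloc a ha
        have := hC.self_of_nhds
        simpa using this
      have hmul : ∀ ζ, f ζ = (ζ - a) * dslope f a ζ := by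
        intro ζ
        have := sub_smul_dslope f a ζ
        simp only [smul_eq_mul, hfa, sub_zero] at this
        exact this.symm
      have hds : DifferentiableOn ℂ (dslope f a) U :=
        (Complex.differentiableOn_dslope (hU.mem_nhds ha)).2 hf
      obtain ⟨g, hg, hgf⟩ := ih Q (dslope f a) hdeg hQ hds (by
        intro b hb
        obtain ⟨C, hC⟩ := hloc b hb
        refine ⟨C, ?_⟩
        have hne : ∀ᶠ ζ in 𝓝 b, ζ ≠ a → ‖dslope f a ζ‖ ≤ C * ‖Q.eval ζ‖ := by
          filter_upwards [hC] with ζ hζ hza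
          rw [hmul ζ] at hζ
          simp only [Polynomial.eval_mul, Polynomial.eval_sub, Polynomial.eval_X,
            Polynomial.eval_C, norm_mul] at hζ
          have : 0 < ‖ζ - a‖ := norm_pos_iff.2 (sub_ne_zero.2 hza)
          nlinarith
        -- Cancelling `ζ - a` yields the bound only off `a`; at `a` it follows by continuity.
        by_cases hba : b = a
        · subst hba
          have hat : ‖dslope f b b‖ ≤ C * ‖Q.eval b‖ := by
            have hc1 : Tendsto (fun ζ => ‖dslope f b ζ‖) (𝓝[≠] b) (𝓝 ‖dslope f b b‖) :=
              ((hds.differentiableAt (hU.mem_nhds hb)).continuousAt.norm.tendsto).mono_left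
                nhdsWithin_le_nhds
            have hc2 : Tendsto (fun ζ => C * ‖Q.eval ζ‖) (𝓝[≠] b) (𝓝 (C * ‖Q.eval b‖)) :=
              ((Q.continuous.norm.const_mul C).tendsto b).mono_left nhdsWithin_le_nhds
            refine le_of_tendsto_of_tendsto hc1 hc2 ?_
            filter_upwards [mem_nhdsWithin_of_mem_nhds hne, self_mem_nhdsWithin] with ζ h1 h2
            exact h1 h2
          filter_upwards [hne] with ζ hζ
          by_cases h : ζ = b
          · rw [h]; exact hat
          · exact hζ h
        · filter_upwards [hne, isOpen_ne.mem_nhds hba] with ζ h1 h2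
          exact h1 h2)
      refine ⟨g, hg, fun ζ hζ => ?_⟩
      rw [hmul ζ, hgf ζ hζ]
      simp only [Polynomial.eval_mul, Polynomial.eval_sub, Polynomial.eval_X, Polynomial.eval_C]
      ring
    · push Not at hroot
      refine ⟨fun ζ => f ζ / P.eval ζ, hf.div P.differentiable.differentiableOn hroot,
        fun ζ hζ => ?_⟩
      rw [mul_div_cancel₀ _ (hroot ζ hζ)]

/-- Maximum principle for the quotient of a holomorphic function by a polynomial dominating it. -/
theorem norm_zero_le_of_locally_le {ρ ρ' : ℝ} (hρ : 0 < ρ) (hρ' : ρ < ρ') {P : Polynomial ℂ}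
    {f : ℂ → ℂ} (hP : P ≠ 0) (hf : DifferentiableOn ℂ f (ball 0 ρ'))
    (hloc : ∀ a ∈ ball (0 : ℂ) ρ', ∃ C : ℝ, ∀ᶠ ζ in 𝓝 a, ‖f ζ‖ ≤ C * ‖P.eval ζ‖)
    {M c : ℝ} (hc : 0 < c) (hfM : ∀ ζ ∈ sphere (0 : ℂ) ρ, ‖f ζ‖ ≤ M)
    (hPc : ∀ ζ ∈ sphere (0 : ℂ) ρ, c ≤ ‖P.eval ζ‖) : ‖f 0‖ ≤ M / c * ‖P.eval 0‖ := by
  obtain ⟨g, hg, hfg⟩ := exists_eq_eval_mul isOpen_ball _ P f rfl hP hf hloc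
  have hsub : closedBall (0 : ℂ) ρ ⊆ ball 0 ρ' := closedBall_subset_ball hρ'
  have hgM : ‖g 0‖ ≤ M / c := by
    refine Complex.norm_le_of_forall_mem_frontier_norm_le (U := ball (0 : ℂ) ρ) isBounded_ball
      ?_ ?_ (subset_closure (mem_ball_self hρ))
    · refine DifferentiableOn.diffContOnCl (hg.mono ?_)
      rw [closure_ball _ hρ.ne']; exact hsub
    · intro ζ hζ
      rw [frontier_ball _ hρ.ne'] at hζ
      have h1 := hfM ζ hζ
      rw [hfg ζ (hsub (sphere_subset_closedBall hζ)), norm_mul] at h1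
      rw [le_div_iff₀ hc]
      have := hPc ζ hζ
      nlinarith [norm_nonneg (g ζ)]
  rw [hfg 0 (hsub (mem_closedBall_self hρ.le)), norm_mul, mul_comm]
  gcongr

/-- Identity theorem on convex open sets, for functions on a normed space. -/
theorem eqOn_of_eqOn_open {X : Type*} [NormedAddCommGroup X] [NormedSpace ℂ X] {U V : Set X}
    (hU : IsOpen U) (hUc : Convex ℝ U) (hV : IsOpen V) (hVU : V ⊆ U) (hne : V.Nonempty)
    {f g : X → ℂ} (hf : DifferentiableOn ℂ f U) (hg : DifferentiableOn ℂ g U)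
    (hfg : EqOn f g V) : EqOn f g U := by
  intro x hx
  obtain ⟨y, hy⟩ := hne
  -- The complex line through `y ∈ V` and `x`: by convexity it meets `U` in a connected set, so the
  -- one-variable identity theorem applies.
  let L : ℂ → X := fun ζ => y + ζ • (x - y)
  have hL : Differentiable ℂ L := by fun_prop
  have hopen : IsOpen (L ⁻¹' U) := hU.preimage hL.continuous
  have hconv : Convex ℝ (L ⁻¹' U) := by
    intro a ha b hb s t hs ht hst
    have : L (s • a + t • b) = s • L a + t • L b := by
      simp only [L, smul_add, add_smul]
      generalize x - y = d
      have h1 : y = s • y + t • y := by rw [← add_smul, hst, one_smul]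
      conv_lhs => rw [h1]
      rw [smul_assoc, smul_assoc]
      abel
    rw [mem_preimage, this]
    exact hUc ha hb hs ht hst
  have hfL : DifferentiableOn ℂ (f ∘ L) (L ⁻¹' U) :=
    hf.comp hL.differentiableOn (mapsTo_preimage _ _)
  have hgL : DifferentiableOn ℂ (g ∘ L) (L ⁻¹' U) :=
    hg.comp hL.differentiableOn (mapsTo_preimage _ _)
  have h0 : (0 : ℂ) ∈ L ⁻¹' U := by simpa [L] using hVU hy
  have h1 : (1 : ℂ) ∈ L ⁻¹' U := by simpa [L] using hx
  have hev : f ∘ L =ᶠ[𝓝 0] g ∘ L := by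
    have : L ⁻¹' V ∈ 𝓝 (0 : ℂ) := (hV.preimage hL.continuous).mem_nhds (by simpa [L] using hy)
    filter_upwards [this] with ζ hζ
    exact hfg hζ
  have := (hfL.analyticOnNhd hopen).eqOn_of_preconnected_of_eventuallyEq
    (hgL.analyticOnNhd hopen) hconv.isPreconnected h0 hev h1
  simpa [L] using this

/-! ### Unitary maps of `ℂ²` and the lines they fix -/

theorem UnitaryMap.det_mul {n : ℕ} (g h : UnitaryMap n) : (g * h).det = g.det * h.det :=
  LinearMap.det_comp _ _

theorem UnitaryMap.norm_det {n : ℕ} (g : UnitaryMap n) : ‖g.det‖ = 1 := by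
  have h := LinearIsometry.normDet_eq_one g.toLinearIsometry
  rw [LinearMap.normDet_eq_norm_det] at h
  exact h

theorem UnitaryMap.det_mul_conj {n : ℕ} (g : UnitaryMap n) : g.det * conj g.det = 1 := by
  rw [Complex.mul_conj, Complex.normSq_eq_norm_sq, g.norm_det]; simp

theorem finrank_of_mem_reflectingHyperplanes {G : Subgroup (UnitaryMap 2)}
    {Y : Submodule ℂ (Cn 2)} (hY : Y ∈ reflectingHyperplanes G) : Module.finrank ℂ Y = 1 := by
  obtain ⟨r, _, hr, rfl⟩ := hY
  have := hr.2
  omega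

theorem finite_reflectingHyperplanes {n : ℕ} (G : Subgroup (UnitaryMap n)) [Finite G] :
    (reflectingHyperplanes G).Finite := by
  have : (G : Set (UnitaryMap n)).Finite := Set.toFinite _
  refine (this.image fixedSpace).subset ?_
  rintro Y ⟨r, hr, _, rfl⟩
  exact ⟨r, hr, rfl⟩

theorem eq_span_singleton {Y : Submodule ℂ (Cn 2)} (hY : Module.finrank ℂ Y = 1) {x : Cn 2}
    (hx : x ∈ Y) (hx0 : x ≠ 0) : Y = Submodule.span ℂ {x} := by
  symm
  apply Submodule.eq_of_le_of_finrank_eq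
  · rw [Submodule.span_singleton_le_iff_mem]; exact hx
  · rw [hY, finrank_span_singleton hx0]

/-- In dimension two a fixed space that is neither zero nor everything is a line. Thus the
stabilizer of a nonzero vector consists of the identity and of reflections in lines through that
vector. -/
theorem isReflection_of_apply_eq {g : UnitaryMap 2} (hg : IsOfFinOrder g) (h1 : g ≠ 1) {x : Cn 2}
    (hx0 : x ≠ 0) (hx : g x = x) : IsReflection g := by
  refine ⟨hg, ?_⟩
  have hle : Module.finrank ℂ (fixedSpace g) ≤ 2 := by
    simpa using (fixedSpace g).finrank_le
  have hne : Module.finrank ℂ (fixedSpace g) ≠ 2 := by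
    intro h
    have htop : fixedSpace g = ⊤ := Submodule.eq_top_of_finrank_eq (by simpa using h)
    apply h1
    ext1 v
    have : v ∈ fixedSpace g := htop ▸ Submodule.mem_top
    exact this
  have hpos : Module.finrank ℂ (fixedSpace g) ≠ 0 := by
    intro h
    have hbot := Submodule.finrank_eq_zero.1 h
    have hmem : x ∈ fixedSpace g := hx
    rw [hbot] at hmem
    exact hx0 ((Submodule.mem_bot ℂ).1 hmem)
  omega

section Normal

variable {Y : Submodule ℂ (Cn 2)} (hY : Module.finrank ℂ Y = 1) {v : Cn 2} (hv : ‖v‖ = 1)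
  (hvY : v ∈ Yᗮ)
include hY hv hvY

theorem orthogonal_eq_span : Yᗮ = Submodule.span ℂ {v} := by
  apply eq_span_singleton _ hvY
  · rintro rfl; simp at hv
  · have h := Y.finrank_add_finrank_orthogonal
    rw [hY, finrank_euclideanSpace_fin] at h
    omega

theorem mem_iff_inner_eq_zero {x : Cn 2} : x ∈ Y ↔ inner ℂ v x = 0 := by
  constructor
  · intro hx
    exact Submodule.inner_left_of_mem_orthogonal hx hvY
  · intro hx
    rw [← Y.orthogonal_orthogonal, orthogonal_eq_span hY hv hvY,
      Submodule.mem_orthogonal_singleton_iff_inner_right]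
    exact hx

theorem sub_inner_smul_mem (x : Cn 2) : x - (inner ℂ v x : ℂ) • v ∈ Y := by
  rw [mem_iff_inner_eq_zero hY hv hvY, inner_sub_right, inner_smul_right,
    inner_self_eq_norm_sq_to_K, hv]
  simp

theorem norm_inner_eq_of_orthogonal {u : Cn 2} (hu : ‖u‖ = 1) (huY : u ∈ Yᗮ) (x : Cn 2) :
    ‖(inner ℂ u x : ℂ)‖ = ‖(inner ℂ v x : ℂ)‖ := by
  rw [orthogonal_eq_span hY hv hvY, Submodule.mem_span_singleton] at huY
  obtain ⟨c, rfl⟩ := huY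
  rw [norm_smul, hv, mul_one] at hu
  rw [inner_smul_left, norm_mul, RCLike.norm_conj, hu, one_mul]

/-- An element fixing a line pointwise acts on the normal direction by its determinant. -/
theorem apply_normal_eq_det_smul {g : UnitaryMap 2} (hg : ∀ y ∈ Y, g y = y) :
    g v = g.det • v := by
  have hgv : g v ∈ Yᗮ := by
    rw [Submodule.mem_orthogonal]
    intro y hy
    rw [← hg y hy, LinearIsometryEquiv.inner_map_map]
    exact Submodule.inner_right_of_mem_orthogonal hy hvY
  rw [orthogonal_eq_span hY hv hvY, Submodule.mem_span_singleton] at hgv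
  obtain ⟨c, hc⟩ := hgv
  -- `g` is the rank-one perturbation `x ↦ x + (c - 1)⟨x, v⟩ v` of the identity, of determinant `1 +
  -- (c - 1)‖v‖² = c`.
  have hT : (g.toLinearEquiv : Cn 2 →ₗ[ℂ] Cn 2) =
      LinearMap.transvection ((c - 1) • (innerSL ℂ v : Cn 2 →ₗ[ℂ] ℂ)) v := by
    ext1 x
    rw [LinearMap.transvection.apply]
    have h1 := hg _ (sub_inner_smul_mem hY hv hvY x)
    rw [map_sub, map_smul, ← hc] at h1
    have h2 : g x = x - (inner ℂ v x : ℂ) • v + (inner ℂ v x : ℂ) • c • v := by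
      rw [← h1]; abel
    change g x = _
    rw [h2]
    simp only [LinearMap.smul_apply, ContinuousLinearMap.coe_coe, innerSL_apply_apply, smul_eq_mul]
    module
  have hdet : g.det = c := by
    rw [UnitaryMap.det, hT, LinearMap.transvection.det]
    simp only [LinearMap.smul_apply, ContinuousLinearMap.coe_coe, innerSL_apply_apply, smul_eq_mul,
      inner_self_eq_norm_sq_to_K, hv]
    simp
  rw [hdet, hc]

theorem eq_one_of_det_eq_one {g : UnitaryMap 2} (hg : ∀ y ∈ Y, g y = y) (hdet : g.det = 1) :
    g = 1 := by
  ext1 x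
  have h1 := hg _ (sub_inner_smul_mem hY hv hvY x)
  rw [map_sub, map_smul, apply_normal_eq_det_smul hY hv hvY hg, hdet, one_smul] at h1
  exact sub_left_injective h1

end Normal

/-- Elements of `G_Y` act on the normal line through their determinants and are determined by them,
which gives `m_Y` distinct scalars. This count produces the vanishing order `m_Y - 1`. -/
theorem exists_det_finset {G : Subgroup (UnitaryMap 2)} [Finite G] {Y : Submodule ℂ (Cn 2)}
    (hY : Module.finrank ℂ Y = 1) {v : Cn 2} (hv : ‖v‖ = 1) (hvY : v ∈ Yᗮ) :
    ∃ Λ : Finset ℂ, Λ.card = reflMultiplicity G Y ∧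
      ∀ l ∈ Λ, ∃ g ∈ pointwiseFixer G Y, l = g.det := by
  classical
  have hle : pointwiseFixer G Y ≤ G := fun g hg => hg.1
  have hfin : Finite (pointwiseFixer G Y) :=
    Finite.of_injective _ (Subgroup.inclusion_injective hle)
  have := Fintype.ofFinite (pointwiseFixer G Y)
  let d : pointwiseFixer G Y → ℂ := fun g => (g : UnitaryMap 2).det
  have hd : Function.Injective d := by
    intro a b hab
    have h1 : (a * b⁻¹ : UnitaryMap 2) = 1 := by
      apply eq_one_of_det_eq_one hY hv hvY (a * b⁻¹).2.2
      have h2 : UnitaryMap.det ((b : UnitaryMap 2) * (b : UnitaryMap 2)⁻¹) = 1 := by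
        rw [mul_inv_cancel]
        exact LinearMap.det_id
      rw [UnitaryMap.det_mul] at h2
      have h3 : (a : UnitaryMap 2).det = (b : UnitaryMap 2).det := hab
      change UnitaryMap.det ((a : UnitaryMap 2) * (b : UnitaryMap 2)⁻¹) = 1
      rw [UnitaryMap.det_mul, h3, h2]
    exact Subtype.ext (mul_inv_eq_one.1 h1)
  refine ⟨Finset.univ.image d, ?_, ?_⟩
  · rw [Finset.card_image_of_injective _ hd, Finset.card_univ, reflMultiplicity,
      Nat.card_eq_fintype_card]
  · intro l hl
    obtain ⟨g, _, rfl⟩ := Finset.mem_image.1 hl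
    exact ⟨g, g.2, rfl⟩

/-! ### Invariance of the Jacobian under the group -/

section Jacobian

variable {G : Subgroup (UnitaryMap 2)}

theorem norm_jacobianPoly [Finite G] (e : Submodule ℂ (Cn 2) → Cn 2) (z : Cn 2) :
    ‖jacobianPoly G e z‖ = ∏ Y ∈ (finite_reflectingHyperplanes G).toFinset,
      ‖(inner ℂ (e Y) z : ℂ)‖ ^ (reflMultiplicity G Y - 1) := by
  rw [jacobianPoly, finprod_mem_eq_finite_toFinset_prod _ (finite_reflectingHyperplanes G),
    norm_prod]
  simp only [norm_pow]

theorem map_fixedSpace (g r : UnitaryMap 2) :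
    (fixedSpace r).map (g.toLinearEquiv : Cn 2 →ₗ[ℂ] Cn 2) = fixedSpace (g * r * g⁻¹) := by
  ext x
  rw [Submodule.mem_map]
  constructor
  · rintro ⟨y, hy, rfl⟩
    change g (r (g.symm (g y))) = g y
    rw [g.symm_apply_apply]
    exact congrArg g hy
  · intro hx
    have hx' : g (r (g.symm x)) = x := hx
    refine ⟨g.symm x, ?_, g.apply_symm_apply x⟩
    change r (g.symm x) = g.symm x
    rw [← g.symm_apply_apply (r (g.symm x)), hx']

theorem map_mem_reflectingHyperplanes {g : UnitaryMap 2} (hg : g ∈ G) {Y : Submodule ℂ (Cn 2)}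
    (hY : Y ∈ reflectingHyperplanes G) :
    Y.map (g.toLinearEquiv : Cn 2 →ₗ[ℂ] Cn 2) ∈ reflectingHyperplanes G := by
  obtain ⟨r, hr, hrefl, rfl⟩ := hY
  refine ⟨g * r * g⁻¹, G.mul_mem (G.mul_mem hg hr) (G.inv_mem hg), ⟨?_, ?_⟩, map_fixedSpace g r⟩
  · have := (MulAut.conj g).toMonoidHom.isOfFinOrder hrefl.1
    simpa using this
  · rw [← map_fixedSpace]
    have : Module.finrank ℂ ((fixedSpace r).map (g.toLinearEquiv : Cn 2 →ₗ[ℂ] Cn 2)) =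
        Module.finrank ℂ (fixedSpace r) := LinearEquiv.finrank_map_eq g.toLinearEquiv _
    rw [this]
    exact hrefl.2

theorem conj_mem_pointwiseFixer {g h : UnitaryMap 2} (hg : g ∈ G) {Y : Submodule ℂ (Cn 2)}
    (hh : h ∈ pointwiseFixer G Y) :
    g * h * g⁻¹ ∈ pointwiseFixer G (Y.map (g.toLinearEquiv : Cn 2 →ₗ[ℂ] Cn 2)) := by
  refine ⟨G.mul_mem (G.mul_mem hg hh.1) (G.inv_mem hg), ?_⟩
  rintro _ ⟨y, hy, rfl⟩
  change g (h (g.symm (g y))) = g y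
  rw [g.symm_apply_apply, hh.2 y hy]

theorem map_map_inv (g : UnitaryMap 2) (Y : Submodule ℂ (Cn 2)) :
    (Y.map (g.toLinearEquiv : Cn 2 →ₗ[ℂ] Cn 2)).map
      ((g⁻¹ : UnitaryMap 2).toLinearEquiv : Cn 2 →ₗ[ℂ] Cn 2) = Y := by
  rw [← Submodule.map_comp]
  convert Submodule.map_id Y using 2
  ext1 x
  exact g.symm_apply_apply x

theorem reflMultiplicity_map {g : UnitaryMap 2} (hg : g ∈ G) (Y : Submodule ℂ (Cn 2)) :
    reflMultiplicity G (Y.map (g.toLinearEquiv : Cn 2 →ₗ[ℂ] Cn 2)) = reflMultiplicity G Y := by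
  let φ : pointwiseFixer G Y ≃
      pointwiseFixer G (Y.map (g.toLinearEquiv : Cn 2 →ₗ[ℂ] Cn 2)) :=
    { toFun := fun h => ⟨g * (h : UnitaryMap 2) * g⁻¹, conj_mem_pointwiseFixer hg h.2⟩
      invFun := fun h => ⟨g⁻¹ * (h : UnitaryMap 2) * g, by
        have := conj_mem_pointwiseFixer (G.inv_mem hg) h.2
        rwa [map_map_inv, inv_inv] at this⟩
      left_inv := fun h => Subtype.ext (by simp only; group)
      right_inv := fun h => Subtype.ext (by simp only; group) }
  exact (Nat.card_congr φ).symm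

/-- `g` permutes the reflecting lines, conjugation by `g` preserves multiplicities, and `g` carries
unit normals to unit normals. Only the modulus is invariant: the image of a chosen root may differ
from the chosen root of the image line by a unimodular factor. -/
theorem norm_jacobianPoly_apply [Finite G] {e : Submodule ℂ (Cn 2) → Cn 2} (he : IsRootChoice G e)
    {g : UnitaryMap 2} (hg : g ∈ G) (z : Cn 2) :
    ‖jacobianPoly G e (g z)‖ = ‖jacobianPoly G e z‖ := by
  rw [norm_jacobianPoly, norm_jacobianPoly]
  symm
  refine Finset.prod_nbij' (fun Y => Y.map (g.toLinearEquiv : Cn 2 →ₗ[ℂ] Cn 2))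
    (fun Y => Y.map ((g⁻¹ : UnitaryMap 2).toLinearEquiv : Cn 2 →ₗ[ℂ] Cn 2)) ?_ ?_ ?_ ?_ ?_
  · intro Y hY
    rw [Set.Finite.mem_toFinset] at hY ⊢
    exact map_mem_reflectingHyperplanes hg hY
  · intro Y hY
    rw [Set.Finite.mem_toFinset] at hY ⊢
    exact map_mem_reflectingHyperplanes (G.inv_mem hg) hY
  · intro Y _
    exact map_map_inv g Y
  · intro Y _
    simpa using map_map_inv g⁻¹ Y
  · intro Y hY
    rw [Set.Finite.mem_toFinset] at hY
    rw [reflMultiplicity_map hg]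
    congr 1
    have hgY := map_mem_reflectingHyperplanes hg hY
    have h1 : ‖g (e Y)‖ = 1 := by rw [g.norm_map]; exact (he Y hY).1
    have h2 : g (e Y) ∈ (Y.map (g.toLinearEquiv : Cn 2 →ₗ[ℂ] Cn 2))ᗮ := by
      rw [Submodule.mem_orthogonal]
      rintro _ ⟨y, hy, rfl⟩
      change inner ℂ (g y) (g (e Y)) = 0
      rw [LinearIsometryEquiv.inner_map_map]
      exact Submodule.inner_right_of_mem_orthogonal hy (he Y hY).2
    rw [norm_inner_eq_of_orthogonal (finrank_of_mem_reflectingHyperplanes hgY) h1 h2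
      (he _ hgY).1 (he _ hgY).2, LinearIsometryEquiv.inner_map_map]

theorem generatedSubgroup_le (G : Subgroup (UnitaryMap 2)) (S : Set (Submodule ℂ (Cn 2))) :
    generatedSubgroup G S ≤ G := by
  rw [generatedSubgroup, Subgroup.closure_le]
  exact iUnion₂_subset fun Y _ g hg => hg.1

/-- Gives the lines of `S` the same multiplicity in `G` and in `G_S`, so that their factors in the
two Jacobians agree in modulus. -/
theorem pointwiseFixer_generatedSubgroup {S : Set (Submodule ℂ (Cn 2))} {Y : Submodule ℂ (Cn 2)}
    (hY : Y ∈ S) : pointwiseFixer (generatedSubgroup G S) Y = pointwiseFixer G Y := by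
  ext g
  refine ⟨fun h => ⟨generatedSubgroup_le G S h.1, h.2⟩, fun h => ⟨Subgroup.subset_closure ?_, h.2⟩⟩
  exact mem_biUnion hY h

end Jacobian

/-! ### Domination of semi-invariant functions by the Jacobian -/

theorem dense_compl_span_singleton (v : Cn 2) :
    Dense ((Submodule.span ℂ {v} : Submodule ℂ (Cn 2)) : Set (Cn 2))ᶜ := by
  rw [← interior_eq_empty_iff_dense_compl]
  by_contra h
  have hne : (𝓝[{x : ℂ | IsUnit x}] (0 : ℂ)).NeBot := by
    have : {x : ℂ | IsUnit x} = {0}ᶜ := by ext; simp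
    rw [this]; infer_instance
  have htop := Submodule.eq_top_of_nonempty_interior' _ (nonempty_iff_ne_empty.2 h)
  have h1 : Module.finrank ℂ (Submodule.span ℂ {v} : Submodule ℂ (Cn 2)) ≤ 1 := by
    simpa using finrank_span_le_card ({v} : Set (Cn 2))
  rw [htop, finrank_top, finrank_euclideanSpace_fin] at h1
  omega

variable {G : Subgroup (UnitaryMap 2)}

theorem jacobianPoly_eq_prod [Finite G] (e : Submodule ℂ (Cn 2) → Cn 2) (z : Cn 2) :
    jacobianPoly G e z = ∏ Y ∈ (finite_reflectingHyperplanes G).toFinset,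
      (inner ℂ (e Y) z : ℂ) ^ (reflMultiplicity G Y - 1) := by
  rw [jacobianPoly, finprod_mem_eq_finite_toFinset_prod _ (finite_reflectingHyperplanes G)]

theorem continuous_jacobianPoly [Finite G] (e : Submodule ℂ (Cn 2) → Cn 2) :
    Continuous (jacobianPoly G e) := by
  have : jacobianPoly G e = fun z => ∏ Y ∈ (finite_reflectingHyperplanes G).toFinset,
      (inner ℂ (e Y) z : ℂ) ^ (reflMultiplicity G Y - 1) := funext (jacobianPoly_eq_prod e)
  rw [this]
  fun_prop

theorem jacobianPoly_ne_zero [Finite G] {e : Submodule ℂ (Cn 2) → Cn 2} (he : IsRootChoice G e)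
    {z : Cn 2} (hz : ∀ Y ∈ reflectingHyperplanes G, z ∉ Y) : jacobianPoly G e z ≠ 0 := by
  rw [jacobianPoly_eq_prod, Finset.prod_ne_zero_iff]
  intro Y hY
  rw [Set.Finite.mem_toFinset] at hY
  exact pow_ne_zero _ fun h => hz Y hY
    ((mem_iff_inner_eq_zero (finrank_of_mem_reflectingHyperplanes hY) (he Y hY).1 (he Y hY).2).2 h)

/-- Near a nonzero point of a reflecting line, the Jacobian is comparable to the power of the
linear form of that line. -/
theorem exists_norm_jacobianPoly_eq_mul [Finite G] {e : Submodule ℂ (Cn 2) → Cn 2}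
    (he : IsRootChoice G e) {Y : Submodule ℂ (Cn 2)} (hY : Y ∈ reflectingHyperplanes G) {x : Cn 2}
    (hx0 : x ≠ 0) (hx : x ∈ Y) : ∃ q : Cn 2 → ℝ, Continuous q ∧ 0 < q x ∧
      ∀ z, ‖jacobianPoly G e z‖ = ‖(inner ℂ (e Y) z : ℂ)‖ ^ (reflMultiplicity G Y - 1) * q z := by
  classical
  set T := (finite_reflectingHyperplanes G).toFinset
  have hYT : Y ∈ T := (Set.Finite.mem_toFinset _).2 hY
  refine ⟨fun z => ∏ X ∈ T.erase Y, ‖(inner ℂ (e X) z : ℂ)‖ ^ (reflMultiplicity G X - 1),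
    by fun_prop, ?_, fun z => ?_⟩
  · refine Finset.prod_pos fun X hX => pow_pos (norm_pos_iff.2 fun h => ?_) _
    obtain ⟨hne, hXT⟩ := Finset.mem_erase.1 hX
    have hXR := (Set.Finite.mem_toFinset _).1 hXT
    have hX1 := finrank_of_mem_reflectingHyperplanes hXR
    have hxX := (mem_iff_inner_eq_zero hX1 (he X hXR).1 (he X hXR).2).2 h
    apply hne
    rw [eq_span_singleton hX1 hxX hx0,
      eq_span_singleton (finrank_of_mem_reflectingHyperplanes hY) hx hx0]
  · rw [norm_jacobianPoly, Finset.mul_prod_erase T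
      (fun X => ‖(inner ℂ (e X) z : ℂ)‖ ^ (reflMultiplicity G X - 1)) hYT]

/-- A function semi-invariant under the reflections in a line is divisible by the Jacobian near
the nonzero points of this line. -/
theorem exists_locally_le_of_mem [Finite G] {e : Submodule ℂ (Cn 2) → Cn 2}
    (he : IsRootChoice G e) {U : Set (Cn 2)} (hU : IsOpen U) {f : Cn 2 → ℂ} {M : ℝ}
    (hf : DifferentiableOn ℂ f U) (hM : ∀ x ∈ U, ‖f x‖ ≤ M) {Y : Submodule ℂ (Cn 2)}
    (hY : Y ∈ reflectingHyperplanes G)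
    (hinv : ∀ g ∈ pointwiseFixer G Y, ∀ x ∈ U, g.det * f (g x) = f x) {x₁ : Cn 2} (hx₁ : x₁ ∈ U)
    (hx0 : x₁ ≠ 0) (hxY : x₁ ∈ Y) :
    ∃ C : ℝ, ∀ᶠ x in 𝓝 x₁, ‖f x‖ ≤ C * ‖jacobianPoly G e x‖ := by
  have hY1 := finrank_of_mem_reflectingHyperplanes hY
  obtain ⟨hv, hvY⟩ := he Y hY
  set v := e Y with hvdef
  obtain ⟨q, hq, hq0, hJ⟩ := exists_norm_jacobianPoly_eq_mul he hY hx0 hxY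
  obtain ⟨ε, hε, hεU⟩ := Metric.isOpen_iff.1 hU x₁ hx₁
  have hM0 : 0 ≤ M := (norm_nonneg _).trans (hM x₁ hx₁)
  -- `y + ζ • v - x₁` will be the sum of `x - x₁`, `-c • v` and `ζ • v`, each of norm less than `δ`.
  set δ := ε / 3 with hδdef
  have hδ : 0 < δ := by positivity
  obtain ⟨Λ, hΛc, hΛ⟩ := exists_det_finset (G := G) hY1 hv hvY
  have hm : 1 ≤ reflMultiplicity G Y := by
    have : Finite (pointwiseFixer G Y) := Finite.of_injective _
      (Subgroup.inclusion_injective (fun g hg => hg.1 : pointwiseFixer G Y ≤ G))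
    exact Nat.card_pos
  set k := reflMultiplicity G Y - 1 with hk
  refine ⟨M / δ ^ k / (q x₁ / 2), ?_⟩
  filter_upwards [ball_mem_nhds x₁ hδ, hq.continuousAt.eventually (lt_mem_nhds (half_lt_self hq0))]
    with x hx hqx
  set c : ℂ := inner ℂ v x with hc
  set y := x - c • v with hy
  have hyY : y ∈ Y := sub_inner_smul_mem hY1 hv hvY x
  have hcx : ‖c‖ < δ := by
    have h1 : (inner ℂ v x₁ : ℂ) = 0 := (mem_iff_inner_eq_zero hY1 hv hvY).1 hxY
    have h2 : c = inner ℂ v (x - x₁) := by rw [inner_sub_right, h1, sub_zero]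
    rw [h2]
    refine (norm_inner_le_norm _ _).trans_lt ?_
    rw [hv, one_mul, ← dist_eq_norm]
    exact hx
  have hmemU : ∀ ζ ∈ ball (0 : ℂ) δ, y + ζ • v ∈ U := by
    intro ζ hζ
    apply hεU
    rw [mem_ball, dist_eq_norm]
    have h1 : y + ζ • v - x₁ = (x - x₁) - c • v + ζ • v := by rw [hy]; abel
    rw [h1]
    refine (norm_add_le _ _).trans_lt ?_
    have h2 := norm_sub_le (x - x₁) (c • v)
    have h3 : ‖x - x₁‖ < δ := by rw [← dist_eq_norm]; exact hx
    have h4 : ‖ζ‖ < δ := by simpa using hζ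
    rw [norm_smul, hv, mul_one] at h2 ⊢
    linarith
  have hxy : f x = f (y + c • v) := by rw [hy]; congr 1; abel
  -- On the slice normal to `Y`, an element `g` of `G_Y` multiplies `ζ` by `g.det`. The weight
  -- therefore starts at `j = 1`, and the `m_Y` scalars leave `k = m_Y - 1` divisions.
  have hbound := norm_le_pow_of_semiinvariant (Λ := Λ) hδ k 1
    (fun ζ => f (y + ζ • v)) M le_rfl (by omega)
    (hf.comp (by fun_prop) hmemU) (fun ζ hζ => hM _ (hmemU ζ hζ))
    (fun l hl ζ hζ _ => by
      obtain ⟨g, hg, rfl⟩ := hΛ l hl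
      have h1 := hinv g hg _ (hmemU ζ hζ)
      rw [map_add, map_smul, hg.2 y hyY, apply_normal_eq_det_smul hY1 hv hvY hg.2, smul_smul,
        mul_comm ζ] at h1
      rw [pow_one]; exact h1) c (by simpa using hcx)
  rw [hxy]
  refine hbound.trans ?_
  rw [hJ x, div_pow]
  have h5 : M / δ ^ k * ‖c‖ ^ k * (q x₁ / 2) ≤ M / δ ^ k * ‖c‖ ^ k * q x := by gcongr
  calc M * (‖c‖ ^ k / δ ^ k) = (M / δ ^ k * ‖c‖ ^ k * (q x₁ / 2)) / (q x₁ / 2) := by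
        field_simp
    _ ≤ (M / δ ^ k * ‖c‖ ^ k * q x) / (q x₁ / 2) := by gcongr
    _ = _ := by ring

theorem exists_locally_le_of_notMem [Finite G] {e : Submodule ℂ (Cn 2) → Cn 2}
    (he : IsRootChoice G e) {U : Set (Cn 2)} (hU : IsOpen U) {f : Cn 2 → ℂ} {M : ℝ}
    (hM : ∀ x ∈ U, ‖f x‖ ≤ M) {x₁ : Cn 2} (hx₁ : x₁ ∈ U)
    (hx : ∀ Y ∈ reflectingHyperplanes G, x₁ ∉ Y) :
    ∃ C : ℝ, ∀ᶠ x in 𝓝 x₁, ‖f x‖ ≤ C * ‖jacobianPoly G e x‖ := by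
  have hJ : 0 < ‖jacobianPoly G e x₁‖ := norm_pos_iff.2 (jacobianPoly_ne_zero he hx)
  have hM0 : 0 ≤ M := (norm_nonneg _).trans (hM x₁ hx₁)
  refine ⟨M / (‖jacobianPoly G e x₁‖ / 2), ?_⟩
  filter_upwards [hU.mem_nhds hx₁, (continuous_jacobianPoly e).norm.continuousAt.eventually
    (lt_mem_nhds (half_lt_self hJ))] with x hxU hlt
  refine (hM x hxU).trans ?_
  rw [div_mul_eq_mul_div, le_div_iff₀ (by positivity)]
  gcongr

/-- A bounded holomorphic function near `z₀` that is semi-invariant under the reflections of `G`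
fixing `z₀` is dominated by the Jacobian of `G`, uniformly. -/
theorem exists_norm_le_jacobianPoly [Finite G] {e : Submodule ℂ (Cn 2) → Cn 2}
    (he : IsRootChoice G e) (z₀ : Cn 2) {R : ℝ} (hR : 0 < R) :
    ∃ r > 0, ∃ C : ℝ, 0 ≤ C ∧ ∀ (f : Cn 2 → ℂ) (M : ℝ), DifferentiableOn ℂ f (ball z₀ R) →
      (∀ x ∈ ball z₀ R, ‖f x‖ ≤ M) →
      (∀ Y ∈ reflectingHyperplanes G, z₀ ∈ Y → ∀ g ∈ pointwiseFixer G Y, ∀ x ∈ ball z₀ R,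
        g.det * f (g x) = f x) →
      ∀ x ∈ ball z₀ r, ‖f x‖ ≤ C * M * ‖jacobianPoly G e x‖ := by
  classical
  set T := (finite_reflectingHyperplanes G).toFinset with hTdef
  have hT : ∀ Y, Y ∈ T ↔ Y ∈ reflectingHyperplanes G := fun Y => Set.Finite.mem_toFinset _
  have hev : ∀ᶠ x in 𝓝 z₀, ∀ Y ∈ T, z₀ ∉ Y → x ∉ Y := by
    rw [Filter.eventually_all_finset]
    intro Y _
    by_cases h : z₀ ∈ Y
    · exact Eventually.of_forall fun x hx => absurd h hx
    · filter_upwards [(Submodule.closed_of_finiteDimensional Y).isOpen_compl.mem_nhds h]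
        with x hx _ using hx
  obtain ⟨R₁, hR₁, hR₁T⟩ := Metric.eventually_nhds_iff_ball.1 hev
  set R₀ := min R R₁ with hR₀def
  have hR₀ : 0 < R₀ := lt_min hR hR₁
  obtain ⟨v, hv⟩ : ∃ v : Cn 2, ∀ Y ∈ T, v ∉ Y := by
    by_contra! hcon
    have huniv : (⋃ p ∈ T, (p : Set (Cn 2))) = univ := by
      refine eq_univ_of_forall fun x => ?_
      obtain ⟨Y, hY, hxY⟩ := hcon x
      exact mem_biUnion hY hxY
    have htop := Subspace.top_mem_of_biUnion_eq_univ huniv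
    have h1 := finrank_of_mem_reflectingHyperplanes ((hT _).1 htop)
    rw [finrank_top, finrank_euclideanSpace_fin] at h1
    omega
  let P : Cn 2 → Polynomial ℂ := fun x => ∏ Y ∈ T,
    (Polynomial.C (inner ℂ (e Y) v : ℂ) * Polynomial.X +
      Polynomial.C (inner ℂ (e Y) x : ℂ)) ^ (reflMultiplicity G Y - 1)
  have hPeval : ∀ x ζ, (P x).eval ζ = jacobianPoly G e (x + ζ • v) := by
    intro x ζ
    rw [jacobianPoly_eq_prod, Polynomial.eval_prod]
    refine Finset.prod_congr rfl fun Y _ => ?_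
    simp only [Polynomial.eval_pow, Polynomial.eval_add, Polynomial.eval_mul, Polynomial.eval_C,
      Polynomial.eval_X, inner_add_right, inner_smul_right]
    ring
  have hP0 : ∀ x, P x ≠ 0 := by
    intro x
    refine Finset.prod_ne_zero_iff.2 fun Y hY => pow_ne_zero _ fun h => ?_
    have h1 := congrArg (fun Q => Q.coeff 1) h
    simp only [Polynomial.coeff_add, Polynomial.coeff_C_mul, Polynomial.coeff_X_one, mul_one,
      Polynomial.coeff_C_of_ne_zero one_ne_zero, add_zero, Polynomial.coeff_zero] at h1
    have hYR := (hT Y).1 hY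
    exact hv Y hY ((mem_iff_inner_eq_zero (finrank_of_mem_reflectingHyperplanes hYR)
      (he Y hYR).1 (he Y hYR).2).2 h1)
  -- Keeps `x + ζ • v` within `R₀ / 2` of `x`; the `+ 1` covers `v = 0`, possible when there are no
  -- reflecting lines.
  set ρ' := R₀ / (2 * (‖v‖ + 1)) with hρ'def
  have hv1 : 0 < ‖v‖ + 1 := by positivity
  have hρ'0 : 0 < ρ' := by positivity
  -- Since `ρ` avoids the moduli of the roots of `P z₀`, the Jacobian does not vanish on the circle.
  -- Compactness gives a lower bound `c` valid for all `x` near `z₀`, hence a constant `1 / c`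
  -- independent of `f`.
  obtain ⟨ρ, ⟨hρ, hρρ'⟩, hρroot⟩ :=
    (Ioo_infinite hρ'0).exists_notMem_finset ((P z₀).roots.toFinset.image norm)
  have hsph : ∀ ζ ∈ sphere (0 : ℂ) ρ, jacobianPoly G e (z₀ + ζ • v) ≠ 0 := by
    intro ζ hζ h0
    apply hρroot
    rw [Finset.mem_image]
    refine ⟨ζ, ?_, by simpa using hζ⟩
    rw [Multiset.mem_toFinset, Polynomial.mem_roots (hP0 z₀), Polynomial.IsRoot, hPeval, h0]
  have hJc := (continuous_jacobianPoly (G := G) e).norm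
  obtain ⟨c, hc, hcJ⟩ : ∃ c > 0, ∀ ζ ∈ sphere (0 : ℂ) ρ, c < ‖jacobianPoly G e (z₀ + ζ • v)‖ := by
    obtain ⟨a, ha, hmin⟩ := (isCompact_sphere (0 : ℂ) ρ).exists_isMinOn
      (NormedSpace.sphere_nonempty.2 hρ.le)
      (f := fun ζ => ‖jacobianPoly G e (z₀ + ζ • v)‖)
      (hJc.comp (by fun_prop : Continuous fun ζ : ℂ => z₀ + ζ • v)).continuousOn
    have hpos := norm_pos_iff.2 (hsph a ha)
    exact ⟨_, half_pos hpos, fun ζ hζ => (half_lt_self hpos).trans_le (hmin hζ)⟩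
  have hev2 : ∀ᶠ x in 𝓝 z₀, ∀ ζ ∈ sphere (0 : ℂ) ρ, c < ‖jacobianPoly G e (x + ζ • v)‖ := by
    refine (isCompact_sphere (0 : ℂ) ρ).eventually_forall_of_forall_eventually fun ζ hζ => ?_
    have hcont : Continuous fun p : Cn 2 × ℂ => ‖jacobianPoly G e (p.1 + p.2 • v)‖ :=
      hJc.comp (by fun_prop)
    exact hcont.continuousAt.eventually (lt_mem_nhds (hcJ ζ hζ))
  obtain ⟨r₁, hr₁, hr₁J⟩ := Metric.eventually_nhds_iff_ball.1 hev2
  refine ⟨min r₁ (R₀ / 2), lt_min hr₁ (half_pos hR₀), 1 / c, by positivity, ?_⟩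
  intro f M hf hM hinv
  have hsubR : ball z₀ R₀ ⊆ ball z₀ R := ball_subset_ball (min_le_left _ _)
  have hM0 : 0 ≤ M := (norm_nonneg _).trans (hM z₀ (mem_ball_self hR))
  have hloc : ∀ x₁ ∈ ball z₀ R₀, x₁ ≠ 0 →
      ∃ C : ℝ, ∀ᶠ x in 𝓝 x₁, ‖f x‖ ≤ C * ‖jacobianPoly G e x‖ := by
    intro x₁ hx₁ hx0
    by_cases h : ∀ Y ∈ reflectingHyperplanes G, x₁ ∉ Y
    · exact exists_locally_le_of_notMem he isOpen_ball hM (hsubR hx₁) h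
    · push Not at h
      obtain ⟨Y, hY, hxY⟩ := h
      have hzY : z₀ ∈ Y := by
        by_contra hcon
        exact hR₁T x₁ (ball_subset_ball (min_le_right _ _) hx₁) Y ((hT Y).2 hY) hcon hxY
      exact exists_locally_le_of_mem he isOpen_ball hf hM hY (hinv Y hY hzY) (hsubR hx₁) hx0 hxY
  -- For `x` outside the line spanned by `v`, the slice misses the origin and `hloc` applies all
  -- along it.
  have hgen : ∀ x ∈ ball z₀ (min r₁ (R₀ / 2)), x ∉ (Submodule.span ℂ {v} : Submodule ℂ (Cn 2)) →
      ‖f x‖ ≤ 1 / c * M * ‖jacobianPoly G e x‖ := by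
    intro x hx hxv
    have hxR : dist x z₀ < R₀ / 2 := (mem_ball.1 hx).trans_le (min_le_right _ _)
    have hmem : ∀ ζ ∈ ball (0 : ℂ) ρ', x + ζ • v ∈ ball z₀ R₀ := by
      intro ζ hζ
      have h1 : ‖ζ‖ < ρ' := by simpa using hζ
      have h2 : ‖ζ‖ * ‖v‖ ≤ R₀ / 2 := by
        calc ‖ζ‖ * ‖v‖ ≤ ρ' * (‖v‖ + 1) := by gcongr; linarith
          _ = R₀ / 2 := by rw [hρ'def]; field_simp
      rw [mem_ball, dist_eq_norm]
      calc ‖x + ζ • v - z₀‖ = ‖(x - z₀) + ζ • v‖ := by congr 1; abel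
        _ ≤ ‖x - z₀‖ + ‖ζ • v‖ := norm_add_le _ _
        _ < R₀ / 2 + R₀ / 2 := by
            rw [norm_smul]; rw [dist_eq_norm] at hxR; linarith
        _ = R₀ := by ring
    have hne : ∀ ζ : ℂ, x + ζ • v ≠ 0 := by
      intro ζ h0
      apply hxv
      rw [Submodule.mem_span_singleton]
      exact ⟨-ζ, by rw [neg_smul]; exact (eq_neg_of_add_eq_zero_left h0).symm⟩
    have hL : Continuous fun ζ : ℂ => x + ζ • v := by fun_prop
    have key := norm_zero_le_of_locally_le hρ hρρ' (f := fun ζ => f (x + ζ • v)) (hP0 x)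
      ((hf.mono hsubR).comp (by fun_prop) hmem)
      (fun a ha => by
        obtain ⟨C, hC⟩ := hloc _ (hmem a ha) (hne a)
        refine ⟨C, ?_⟩
        filter_upwards [hL.continuousAt.eventually hC] with ζ hζ
        rw [hPeval]; exact hζ)
      hc (fun ζ hζ => hM _ (hsubR (hmem ζ ((sphere_subset_closedBall.trans
        (closedBall_subset_ball hρρ')) hζ))))
      (fun ζ hζ => by
        rw [hPeval]
        exact (hr₁J x (ball_subset_ball (min_le_left _ _) hx) ζ hζ).le)
    rw [hPeval, zero_smul, add_zero] at key
    convert key using 2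
    ring
  intro x hx
  -- The exceptional slice has dense complement, so continuity extends the bound to it.
  have hxcl : x ∈ closure ((Submodule.span ℂ {v} : Submodule ℂ (Cn 2)) : Set (Cn 2))ᶜ :=
    dense_compl_span_singleton v x
  have hnb := mem_closure_iff_nhdsWithin_neBot.1 hxcl
  have hxR : x ∈ ball z₀ R :=
    hsubR (ball_subset_ball ((min_le_right _ _).trans (half_le_self hR₀.le)) hx)
  have hcf : ContinuousAt f x := (hf.differentiableAt (isOpen_ball.mem_nhds hxR)).continuousAt
  refine le_of_tendsto_of_tendsto (hcf.norm.tendsto.mono_left nhdsWithin_le_nhds)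
    (((hJc.const_mul _).tendsto x).mono_left nhdsWithin_le_nhds)
    (b := 𝓝[((Submodule.span ℂ {v} : Submodule ℂ (Cn 2)) : Set (Cn 2))ᶜ] x) ?_
  filter_upwards [mem_nhdsWithin_of_mem_nhds (isOpen_ball.mem_nhds hx), self_mem_nhdsWithin]
    with y h1 h2 using hgen y h1 h2

/-! ### Unitary invariance of the Bergman kernel and extension across the boundary -/

theorem bergmanKernel_unitary {n : ℕ} {E : Set (Cn n)} (hE : IsOpen E) (g : UnitaryMap n)
    (hg : ∀ z, g z ∈ E ↔ z ∈ E) {z w : Cn n} (hz : z ∈ E) (hw : w ∈ E) :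
    bergmanKernel E (g z) (g w) = bergmanKernel E z w := by
  have hK := bergmanKernel_spec hE
  have hpre : (fun x => g x) ⁻¹' E = E := by ext x; exact hg x
  let gR : Cn n ≃ₗᵢ[ℝ] Cn n :=
    { g.toLinearEquiv.restrictScalars ℝ with norm_map' := g.norm_map }
  have hmp : MeasurePreserving (fun x => g x) (volume : Measure (Cn n)) volume :=
    LinearIsometryEquiv.measurePreserving gR
  have hemb : MeasurableEmbedding (fun x => g x) := g.toHomeomorph.measurableEmbedding
  have hmpE : MeasurePreserving (fun x => g x) (volume.restrict E) (volume.restrict E) := by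
    have := hmp.restrict_preimage_emb hemb E
    rwa [hpre] at this
  have hsymm : ∀ x, g.symm x ∈ E ↔ x ∈ E := fun x => by
    rw [← hg (g.symm x), g.apply_symm_apply]
  have hmpE' : MeasurePreserving (fun x => g.symm x) (volume.restrict E) (volume.restrict E) :=
    MeasurePreserving.symm (g.toHomeomorph.toMeasurableEquiv) hmpE
  have hcomp : ∀ f, IsBergman E f → IsBergman E (fun x => f (g x)) := fun f hf =>
    ⟨hf.holo.comp g.differentiable.differentiableOn (fun x hx => (hg x).2 hx),
      hf.memLp.comp_measurePreserving hmpE⟩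
  have hcomp' : ∀ f, IsBergman E f → IsBergman E (fun x => f (g.symm x)) := fun f hf =>
    ⟨hf.holo.comp g.symm.differentiable.differentiableOn (fun x hx => (hsymm x).2 hx),
      hf.memLp.comp_measurePreserving hmpE'⟩
  -- The transported kernel also reproduces, so uniqueness identifies it with the original one.
  have hL : IsBergmanKernel E (fun z w => bergmanKernel E (g z) (g w)) := by
    refine ⟨fun w hw => hcomp _ (hK.mem (g w) ((hg w).2 hw)), fun w hw f hf => ?_⟩
    have h1 := hK.reproducing (g w) ((hg w).2 hw) _ (hcomp' f hf)
    rw [g.symm_apply_apply] at h1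
    rw [← h1, ← hmpE.integral_comp hemb (fun x => f (g.symm x) * conj (bergmanKernel E x (g w)))]
    simp only [LinearIsometryEquiv.symm_apply_apply]
  exact hL.eqOn hK z hz w hw

section Conjugation

variable {n : ℕ}

@[simp]
theorem conjVec_conjVec (w : Cn n) : conjVec (conjVec w) = w := by
  ext i; simp [conjVec]

/-- Componentwise conjugation as a conjugate-linear isometry. -/
noncomputable def conjVecLI (n : ℕ) : Cn n →ₛₗᵢ[starRingEnd ℂ] Cn n where
  toFun := conjVec
  map_add' a b := by ext i; simp [conjVec]
  map_smul' c a := by ext i; simp [conjVec]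
  norm_map' a := by simp [conjVec, EuclideanSpace.norm_eq]

theorem dist_conjVec (a b : Cn n) : dist (conjVec a) (conjVec b) = dist a b :=
  (conjVecLI n).dist_map a b

theorem continuous_conjVec : Continuous (conjVec : Cn n → Cn n) := (conjVecLI n).continuous

theorem differentiableOn_conj_comp_conjVec {f : Cn n → ℂ} {U V : Set (Cn n)}
    (hf : ∀ x ∈ V, DifferentiableAt ℂ f x) (hUV : ∀ w ∈ U, conjVec w ∈ V) :
    DifferentiableOn ℂ (fun w => conj (f (conjVec w))) U := by
  intro w hw
  have h := DifferentiableAt.comp_semilinear₂ (starL ℂ : ℂ ≃L⋆[ℂ] ℂ).toContinuousLinearMap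
    (conjVecLI n).toContinuousLinearMap (hf (conjVec w) (hUV w hw))
  exact h.differentiableWithinAt

end Conjugation

section Extension

/-- `F` is holomorphic in the first variable in `U`, antiholomorphic in the second variable in
`V`, and bounded by `M` on `U × V`. -/
structure IsSesquiholomorphic (F : Cn 2 → Cn 2 → ℂ) (U V : Set (Cn 2)) (M : ℝ) : Prop where
  left : ∀ w ∈ V, DifferentiableOn ℂ (fun z => F z w) U
  right : ∀ z ∈ U, DifferentiableOn ℂ (fun w => conj (F z w)) V
  bound : ∀ z ∈ U, ∀ w ∈ V, ‖F z w‖ ≤ M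

variable {E : Set (Cn 2)}

theorem mem_doubledDomain {q : Cn 2 × Cn 2} :
    q ∈ doubledDomain E ↔ q.1 ∈ E ∧ conjVec q.2 ∈ E := by
  constructor
  · rintro ⟨z, hz, w, hw, rfl⟩
    exact ⟨hz, by simpa using hw⟩
  · rintro ⟨h1, h2⟩
    exact ⟨q.1, h1, conjVec q.2, h2, by simp⟩

theorem isOpen_doubledDomain (hE : IsOpen E) : IsOpen (doubledDomain E) := by
  have : doubledDomain E = Prod.fst ⁻¹' E ∩ (fun q : Cn 2 × Cn 2 => conjVec q.2) ⁻¹' E := by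
    ext q; exact mem_doubledDomain
  rw [this]
  exact (hE.preimage continuous_fst).inter (hE.preimage (continuous_conjVec.comp continuous_snd))

theorem mem_closure_doubledDomain {z w : Cn 2} (hz : z ∈ closure E) (hw : w ∈ closure E) :
    (z, conjVec w) ∈ closure (doubledDomain E) := by
  have hc : Continuous fun p : Cn 2 × Cn 2 => (p.1, conjVec p.2) :=
    continuous_fst.prodMk (continuous_conjVec.comp continuous_snd)
  have hzw : (z, w) ∈ closure (E ×ˢ E) := by rw [closure_prod_eq]; exact ⟨hz, hw⟩
  exact map_mem_closure (f := fun p : Cn 2 × Cn 2 => (p.1, conjVec p.2)) hc hzw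
    fun p hp => ⟨p.1, hp.1, p.2, hp.2, rfl⟩

theorem frontier_nonempty_of_isBounded (hne : E.Nonempty) (hb : Bornology.IsBounded E) :
    (frontier E).Nonempty := by
  rw [nonempty_iff_ne_empty]
  intro h
  have hclopen : IsClopen E := isClopen_iff_frontier_eq_empty.2 h
  have huniv := hclopen.eq_univ hne
  rw [huniv] at hb
  exact NormedSpace.unbounded_univ ℂ (Cn 2) hb

/-- The kernel is holomorphic on the doubled domain: continuation past one boundary point is
enough. -/
theorem differentiableOn_holoBergmanKernel (hE : IsOpen E) (hb : Bornology.IsBounded E)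
    (h0 : (0 : Cn 2) ∈ E)
    (hK : ∀ q ∈ frontier (doubledDomain E), q.1 ≠ conjVec q.2 →
      ContinuesPast (doubledDomain E) (holoBergmanKernel E) q) :
    DifferentiableOn ℂ (holoBergmanKernel E) (doubledDomain E) := by
  obtain ⟨w, hw⟩ := frontier_nonempty_of_isBounded ⟨0, h0⟩ hb
  have hwE : w ∉ E := by
    rw [hE.frontier_eq] at hw; exact hw.2
  obtain ⟨r, _, F, hF, hFK⟩ := hK (0, conjVec w) (by
    rw [(isOpen_doubledDomain hE).frontier_eq]
    refine ⟨mem_closure_doubledDomain (subset_closure h0) (frontier_subset_closure hw), ?_⟩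
    rw [mem_doubledDomain]
    simpa using fun _ => hwE) (by
    simp only [conjVec_conjVec]
    rintro rfl
    exact hwE h0)
  exact (hF.mono subset_union_left).congr fun q hq => (hFK hq).symm

/-- The Bergman kernel extends across the off-diagonal boundary points. -/
theorem exists_extension (hE : IsOpen E) (hb : Bornology.IsBounded E) (h0 : (0 : Cn 2) ∈ E)
    (hK : ∀ q ∈ frontier (doubledDomain E), q.1 ≠ conjVec q.2 →
      ContinuesPast (doubledDomain E) (holoBergmanKernel E) q)
    {z₀ w₀ : Cn 2} (hz₀ : z₀ ∈ closure E) (hw₀ : w₀ ∈ closure E) (h : z₀ ≠ w₀ ∨ z₀ ∈ E) :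
    ∃ r > 0, ∃ (F : Cn 2 → Cn 2 → ℂ) (M : ℝ),
      IsSesquiholomorphic F (ball z₀ r) (ball w₀ r) M ∧
      ∀ z ∈ E, ∀ w ∈ E, F z w = bergmanKernel E z w := by
  have hcl := mem_closure_doubledDomain hz₀ hw₀
  have hopen := isOpen_doubledDomain hE
  obtain ⟨U, hU, hqU, Φ, hΦ, hΦK⟩ : ∃ U : Set (Cn 2 × Cn 2), IsOpen U ∧ (z₀, conjVec w₀) ∈ U ∧
      ∃ Φ : Cn 2 × Cn 2 → ℂ, DifferentiableOn ℂ Φ U ∧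
        EqOn Φ (holoBergmanKernel E) (doubledDomain E) := by
    -- Inside the doubled domain nothing has to be continued; outside it, `h` leaves only the case
    -- `z₀ ≠ w₀`.
    by_cases hmem : (z₀, conjVec w₀) ∈ doubledDomain E
    · exact ⟨_, hopen, hmem, _, differentiableOn_holoBergmanKernel hE hb h0 hK, fun _ _ => rfl⟩
    · have hne : z₀ ≠ w₀ := by
        rcases h with h | h
        · exact h
        · rintro rfl
          exact hmem ⟨z₀, h, z₀, h, rfl⟩
      obtain ⟨r, hr, F, hF, hFK⟩ := hK (z₀, conjVec w₀)
        (by rw [hopen.frontier_eq]; exact ⟨hcl, hmem⟩) (by simpa using hne)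
      exact ⟨_, hopen.union isOpen_ball, Or.inr (mem_ball_self hr), F, hF, hFK⟩
  have hcont : ContinuousAt Φ (z₀, conjVec w₀) := (hΦ.differentiableAt (hU.mem_nhds hqU)).continuousAt
  have hev : ∀ᶠ q in 𝓝 (z₀, conjVec w₀), q ∈ U ∧ ‖Φ q‖ < ‖Φ (z₀, conjVec w₀)‖ + 1 :=
    (hU.eventually_mem hqU).and (hcont.norm.eventually (gt_mem_nhds (lt_add_one _)))
  obtain ⟨r, hr, hball⟩ := Metric.eventually_nhds_iff_ball.1 hev
  have hmem : ∀ z ∈ ball z₀ r, ∀ u ∈ ball (conjVec w₀) r, (z, u) ∈ ball (z₀, conjVec w₀) r := by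
    intro z hz u hu
    rw [← ball_prod_same]
    exact ⟨hz, hu⟩
  have hcb : ∀ w ∈ ball w₀ r, conjVec w ∈ ball (conjVec w₀) r := by
    intro w hw
    rw [mem_ball, dist_conjVec]; exact hw
  have hdiff : ∀ z ∈ ball z₀ r, ∀ u ∈ ball (conjVec w₀) r, DifferentiableAt ℂ Φ (z, u) :=
    fun z hz u hu => hΦ.differentiableAt (hU.mem_nhds (hball _ (hmem z hz u hu)).1)
  refine ⟨r, hr, fun z w => Φ (z, conjVec w), ‖Φ (z₀, conjVec w₀)‖ + 1, ⟨?_, ?_, ?_⟩, ?_⟩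
  · intro w hw z hz
    have h1 : DifferentiableAt ℂ (fun z : Cn 2 => (z, conjVec w)) z := by fun_prop
    exact ((hdiff z hz _ (hcb w hw)).comp z h1).differentiableWithinAt
  · intro z hz
    refine differentiableOn_conj_comp_conjVec (f := fun u => Φ (z, u)) (V := ball (conjVec w₀) r)
      (fun u hu => ?_) hcb
    have h1 : DifferentiableAt ℂ (fun u : Cn 2 => (z, u)) u := by fun_prop
    exact (hdiff z hz u hu).comp u h1
  · intro z hz w hw
    exact (hball _ (hmem z hz _ (hcb w hw))).2.le
  · intro z hz w hw
    beta_reduce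
    rw [hΦK ⟨z, hz, w, hw, rfl⟩, holoBergmanKernel, conjVec_conjVec]

end Extension

/-! ### Sums of the kernel over subsets of the group -/

variable {E : Set (Cn 2)}

/-- The sum of `K(z, g.w) conj(det g)` over a finite set of unitary maps. -/
noncomputable def partialKernel (E : Set (Cn 2)) (T : Finset (UnitaryMap 2)) (z w : Cn 2) : ℂ :=
  ∑ g ∈ T, bergmanKernel E z (g w) * conj g.det

theorem IsBoundedInvariantDomain.apply_mem_iff (hE : IsBoundedInvariantDomain G E)
    {g : UnitaryMap 2} (hg : g ∈ G) (z : Cn 2) : g z ∈ E ↔ z ∈ E := by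
  refine ⟨fun h => ?_, hE.invariant g hg z⟩
  have := hE.invariant g⁻¹ (G.inv_mem hg) _ h
  rwa [LinearIsometryEquiv.coe_inv, g.symm_apply_apply] at this

theorem IsBoundedInvariantDomain.apply_mem_closure (hE : IsBoundedInvariantDomain G E)
    {g : UnitaryMap 2} (hg : g ∈ G) {z : Cn 2} (hz : z ∈ closure E) : g z ∈ closure E :=
  map_mem_closure g.continuous hz (hE.invariant g hg)

theorem bergmanKernel_apply_left (hE : IsBoundedInvariantDomain G E) {r : UnitaryMap 2}
    (hr : r ∈ G) {z w : Cn 2} (hz : z ∈ E) (hw : w ∈ E) :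
    bergmanKernel E (r z) w = bergmanKernel E z (r⁻¹ w) := by
  have h := bergmanKernel_unitary hE.isOpen r (hE.apply_mem_iff hr) hz
    (hE.invariant r⁻¹ (G.inv_mem hr) w hw)
  rw [← h]
  congr 1
  rw [LinearIsometryEquiv.coe_inv, r.apply_symm_apply]

/-- Moving `r` to the second variable as `r⁻¹` reindexes the sum, and `|det r| = 1` cancels the
factor. Stability of `T` under `r` suffices, so this covers both a group and the complement of a
subgroup. -/
theorem det_mul_partialKernel_left (hE : IsBoundedInvariantDomain G E)
    {T : Finset (UnitaryMap 2)} (hTG : ∀ g ∈ T, g ∈ G) {r : UnitaryMap 2} (hr : r ∈ G)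
    (hT : ∀ g, r * g ∈ T ↔ g ∈ T) {z w : Cn 2} (hz : z ∈ E) (hw : w ∈ E) :
    r.det * partialKernel E T (r z) w = partialKernel E T z w := by
  rw [partialKernel, partialKernel, Finset.mul_sum]
  symm
  refine Finset.sum_bij' (fun g _ => r * g) (fun g _ => r⁻¹ * g) ?_ ?_ ?_ ?_ ?_
  · intro g hg; exact (hT g).2 hg
  · intro g hg; rw [← hT]; simpa using hg
  · intro g _; simp
  · intro g _; simp
  · intro g hg
    have hrg : (r * g) w = r (g w) := rfl
    rw [hrg, bergmanKernel_apply_left hE hr hz (hE.invariant r hr _ (hE.invariant g (hTG g hg) w hw)),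
      LinearIsometryEquiv.coe_inv, r.symm_apply_apply, UnitaryMap.det_mul, map_mul]
    linear_combination (-(bergmanKernel E z (g w) * conj g.det)) * r.det_mul_conj

theorem conj_det_mul_partialKernel_right {T : Finset (UnitaryMap 2)} {r : UnitaryMap 2}
    (hT : ∀ g, g * r ∈ T ↔ g ∈ T) (z w : Cn 2) :
    conj r.det * partialKernel E T z (r w) = partialKernel E T z w := by
  rw [partialKernel, partialKernel, Finset.mul_sum]
  refine Finset.sum_bij' (fun g _ => g * r) (fun g _ => g * r⁻¹) ?_ ?_ ?_ ?_ ?_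
  · intro g hg; exact (hT g).2 hg
  · intro g hg; rw [← hT]; simpa using hg
  · intro g _; simp
  · intro g _; simp
  · intro g hg
    have hrg : (g * r) w = g (r w) := rfl
    rw [hrg, UnitaryMap.det_mul, map_mul]
    ring

/-- The partial kernel extends near `(z₀, w₀)` as soon as all its terms do. -/
theorem exists_extension_partialKernel (hE : IsBoundedInvariantDomain G E)
    (h0 : (0 : Cn 2) ∈ E)
    (hK : ∀ q ∈ frontier (doubledDomain E), q.1 ≠ conjVec q.2 →
      ContinuesPast (doubledDomain E) (holoBergmanKernel E) q)
    {T : Finset (UnitaryMap 2)} (hTG : ∀ g ∈ T, g ∈ G)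
    {z₀ w₀ : Cn 2} (hz₀ : z₀ ∈ closure E) (hw₀ : w₀ ∈ closure E)
    (hext : ∀ g ∈ T, z₀ ≠ g w₀ ∨ z₀ ∈ E) :
    ∃ R > 0, ∃ (F : Cn 2 → Cn 2 → ℂ) (M : ℝ),
      IsSesquiholomorphic F (ball z₀ R) (ball w₀ R) M ∧
      ∀ z ∈ E, ∀ w ∈ E, F z w = partialKernel E T z w := by
  have hone : ∀ g ∈ T, ∃ r > 0, ∃ (F : Cn 2 → Cn 2 → ℂ) (M : ℝ),
      IsSesquiholomorphic F (ball z₀ r) (ball (g w₀) r) M ∧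
      ∀ z ∈ E, ∀ w ∈ E, F z w = bergmanKernel E z w := fun g hg =>
    exists_extension hE.isOpen hE.isBounded h0 hK hz₀ (hE.apply_mem_closure (hTG g hg) hw₀)
      (hext g hg)
  choose! r hr F M hF hFK using hone
  have hev : ∀ᶠ R in 𝓝[>] (0 : ℝ), ∀ g ∈ T, R < r g := by
    rw [Filter.eventually_all_finset]
    intro g hg
    exact mem_nhdsWithin_of_mem_nhds (gt_mem_nhds (hr g hg))
  obtain ⟨R, hRr, hR⟩ := (hev.and self_mem_nhdsWithin).exists
  have hsub : ∀ g ∈ T, ball z₀ R ⊆ ball z₀ (r g) := fun g hg => ball_subset_ball (hRr g hg).le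
  have hmaps : ∀ g ∈ T, ∀ w ∈ ball w₀ R, g w ∈ ball (g w₀) (r g) := by
    intro g hg w hw
    rw [mem_ball, g.dist_map]
    exact (mem_ball.1 hw).trans (hRr g hg)
  refine ⟨R, hR, fun z w => ∑ g ∈ T, F g z (g w) * conj g.det, ∑ g ∈ T, M g, ⟨?_, ?_, ?_⟩, ?_⟩
  · intro w hw
    refine DifferentiableOn.fun_sum fun g hg => ?_
    exact (((hF g hg).left (g w) (hmaps g hg w hw)).mono (hsub g hg)).mul_const _
  · intro z hz
    simp only [map_sum, map_mul]
    refine DifferentiableOn.fun_sum fun g hg => ?_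
    exact (((hF g hg).right z (hsub g hg hz)).comp g.differentiable.differentiableOn
      (hmaps g hg)).mul_const _
  · intro z hz w hw
    refine (norm_sum_le _ _).trans (Finset.sum_le_sum fun g hg => ?_)
    rw [norm_mul, RCLike.norm_conj, g.norm_det, mul_one]
    exact (hF g hg).bound z (hsub g hg hz) _ (hmaps g hg w hw)
  · intro z hz w hw
    exact Finset.sum_congr rfl fun g hg => by
      rw [hFK g hg z hz _ (hE.invariant g (hTG g hg) w hw)]

theorem nonempty_ball_inter {z₀ : Cn 2} (hz₀ : z₀ ∈ closure E) {R : ℝ} (hR : 0 < R) :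
    (ball z₀ R ∩ E).Nonempty :=
  mem_closure_iff_nhds.1 hz₀ _ (ball_mem_nhds z₀ hR)

/-- A partial kernel that extends near `(z₀, w₀)` and is semi-invariant under the reflections
fixing `z₀` and `w₀` is dominated there by `J_G(z) J_G(w)`. -/
theorem exists_norm_partialKernel_le [Finite G] {e : Submodule ℂ (Cn 2) → Cn 2}
    (he : IsRootChoice G e) (hE : IsBoundedInvariantDomain G E) (h0 : (0 : Cn 2) ∈ E)
    (hK : ∀ q ∈ frontier (doubledDomain E), q.1 ≠ conjVec q.2 →
      ContinuesPast (doubledDomain E) (holoBergmanKernel E) q)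
    {T : Finset (UnitaryMap 2)} (hTG : ∀ g ∈ T, g ∈ G)
    {z₀ w₀ : Cn 2} (hz₀ : z₀ ∈ closure E) (hw₀ : w₀ ∈ closure E)
    (hext : ∀ g ∈ T, z₀ ≠ g w₀ ∨ z₀ ∈ E)
    (hleft : ∀ Y ∈ reflectingHyperplanes G, z₀ ∈ Y → ∀ r ∈ pointwiseFixer G Y,
      ∀ g, r * g ∈ T ↔ g ∈ T)
    (hright : ∀ Y ∈ reflectingHyperplanes G, w₀ ∈ Y → ∀ r ∈ pointwiseFixer G Y,
      ∀ g, g * r ∈ T ↔ g ∈ T) :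
    ∃ ε > 0, ∃ C : ℝ, 0 ≤ C ∧ ∀ z ∈ E ∩ ball z₀ ε, ∀ w ∈ E ∩ ball w₀ ε,
      ‖partialKernel E T z w‖ ≤ C * (‖jacobianPoly G e z‖ * ‖jacobianPoly G e w‖) := by
  obtain ⟨R, hR, F, M, hF, hFK⟩ := exists_extension_partialKernel hE h0 hK hTG hz₀ hw₀ hext
  have hM0 : 0 ≤ M := (norm_nonneg _).trans
    (hF.bound z₀ (mem_ball_self hR) w₀ (mem_ball_self hR))
  have hfix : ∀ (x : Cn 2) (Y : Submodule ℂ (Cn 2)), x ∈ Y → ∀ r ∈ pointwiseFixer G Y,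
      ∀ y ∈ ball x R, r y ∈ ball x R := by
    intro x Y hx r hr y hy
    rw [mem_ball, ← hr.2 x hx, r.dist_map]; exact hy
  have hzV := nonempty_ball_inter hz₀ hR
  have hwV := nonempty_ball_inter hw₀ hR
  have hopen : ∀ x : Cn 2, IsOpen (ball x R ∩ E) := fun x => isOpen_ball.inter hE.isOpen
  -- On `E` this is the symmetry of the partial kernel. The identity theorem propagates it to the
  -- balls one variable at a time, after conjugation for the variable `w`.
  have hinvL : ∀ Y ∈ reflectingHyperplanes G, z₀ ∈ Y → ∀ r ∈ pointwiseFixer G Y,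
      ∀ z ∈ ball z₀ R, ∀ w ∈ ball w₀ R, r.det * F (r z) w = F z w := by
    intro Y hY hzY r hr
    have hmaps := hfix z₀ Y hzY r hr
    have h1 : ∀ w ∈ ball w₀ R ∩ E, EqOn (fun z => r.det * F (r z) w) (fun z => F z w)
        (ball z₀ R) := by
      intro w hw
      refine eqOn_of_eqOn_open isOpen_ball (convex_ball _ _) (hopen z₀) inter_subset_left hzV
        (((hF.left w hw.1).comp r.differentiable.differentiableOn hmaps).const_mul _)
        (hF.left w hw.1) fun z hz => ?_
      beta_reduce
      rw [hFK z hz.2 w hw.2, hFK (r z) (hE.invariant r hr.1 z hz.2) w hw.2]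
      exact det_mul_partialKernel_left hE hTG hr.1 (hleft Y hY hzY r hr) hz.2 hw.2
    intro z hz w hw
    have h2 : EqOn (fun w => conj r.det * conj (F (r z) w)) (fun w => conj (F z w))
        (ball w₀ R) := by
      refine eqOn_of_eqOn_open isOpen_ball (convex_ball _ _) (hopen w₀) inter_subset_left hwV
        ((hF.right (r z) (hmaps z hz)).const_mul _) (hF.right z hz) fun w hw => ?_
      have := h1 w hw hz
      beta_reduce at this ⊢
      rw [← map_mul, this]
    have h3 := h2 hw
    beta_reduce at h3
    rw [← map_mul] at h3
    exact (starRingEnd ℂ).injective h3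
  have hinvR : ∀ Y ∈ reflectingHyperplanes G, w₀ ∈ Y → ∀ r ∈ pointwiseFixer G Y,
      ∀ z ∈ ball z₀ R, ∀ w ∈ ball w₀ R, r.det * conj (F z (r w)) = conj (F z w) := by
    intro Y hY hwY r hr
    have hmaps := hfix w₀ Y hwY r hr
    have h1 : ∀ w ∈ ball w₀ R ∩ E, EqOn (fun z => conj r.det * F z (r w)) (fun z => F z w)
        (ball z₀ R) := by
      intro w hw
      refine eqOn_of_eqOn_open isOpen_ball (convex_ball _ _) (hopen z₀) inter_subset_left hzV
        ((hF.left (r w) (hmaps w hw.1)).const_mul _)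
        (hF.left w hw.1) fun z hz => ?_
      beta_reduce
      rw [hFK z hz.2 w hw.2, hFK z hz.2 (r w) (hE.invariant r hr.1 w hw.2)]
      exact conj_det_mul_partialKernel_right (hright Y hY hwY r hr) z w
    intro z hz w hw
    refine eqOn_of_eqOn_open (f := fun w => r.det * conj (F z (r w)))
      (g := fun w => conj (F z w)) isOpen_ball (convex_ball _ _) (hopen w₀) inter_subset_left hwV
      (((hF.right z hz).comp r.differentiable.differentiableOn hmaps).const_mul _)
      (hF.right z hz) (fun w hw => ?_) hw
    have := h1 w hw hz
    beta_reduce at this ⊢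
    rw [← this, map_mul, Complex.conj_conj]
  obtain ⟨r₁, hr₁, C₁, hC₁, hA₁⟩ := exists_norm_le_jacobianPoly he z₀ hR
  obtain ⟨r₂, hr₂, C₂, hC₂, hA₂⟩ := exists_norm_le_jacobianPoly he w₀ hR
  refine ⟨min R (min r₁ r₂), lt_min hR (lt_min hr₁ hr₂), C₂ * (C₁ * M), by positivity, ?_⟩
  rintro z ⟨hzE, hz⟩ w ⟨hwE, hw⟩
  have hzR : z ∈ ball z₀ R := ball_subset_ball (min_le_left _ _) hz
  have hz₁ : z ∈ ball z₀ r₁ := ball_subset_ball ((min_le_right _ _).trans (min_le_left _ _)) hz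
  have hw₂ : w ∈ ball w₀ r₂ := ball_subset_ball ((min_le_right _ _).trans (min_le_right _ _)) hw
  -- The bound in `z` becomes the supremum bound for the function of `w`; a second application then
  -- produces the product of the two Jacobians. This needs `C₁` and `C₂` to be independent of the
  -- function.
  have hstep : ∀ w ∈ ball w₀ R, ‖F z w‖ ≤ C₁ * M * ‖jacobianPoly G e z‖ := fun w hw =>
    hA₁ (fun z => F z w) M (hF.left w hw) (fun x hx => hF.bound x hx w hw)
      (fun Y hY hzY g hg x hx => hinvL Y hY hzY g hg x hx w hw) z hz₁
  have h := hA₂ (fun w => conj (F z w)) (C₁ * M * ‖jacobianPoly G e z‖) (hF.right z hzR)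
    (fun x hx => by rw [RCLike.norm_conj]; exact hstep x hx)
    (fun Y hY hwY g hg x hx => hinvR Y hY hwY g hg z hzR x hx) w hw₂
  rw [RCLike.norm_conj, hFK z hzE w hwE] at h
  refine h.trans (le_of_eq ?_)
  ring

/-! ### Local estimates for the weighted kernel -/

theorem averagedKernel_eq_partialKernel [Finite G] {T : Finset (UnitaryMap 2)}
    (hT : ∀ g, g ∈ T ↔ g ∈ G) (z w : Cn 2) :
    averagedKernel E G z w = (1 / (Nat.card G : ℂ)) * partialKernel E T z w := by
  have := Fintype.ofFinite G
  rw [averagedKernel, partialKernel, finsum_eq_sum_of_fintype]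
  congr 1
  exact (Finset.sum_subtype T hT
    (fun g : UnitaryMap 2 => bergmanKernel E z (g w) * conj g.det)).symm

theorem norm_weightedKernel (e : Submodule ℂ (Cn 2) → Cn 2) (p : ℝ) (z w : Cn 2) :
    ‖weightedKernel E G e p z w‖ = ‖jacobianPoly G e z‖ ^ (2 / p - 1) *
      ‖averagedKernel E G z w‖ * ‖jacobianPoly G e w‖ ^ (1 - 2 / p) := by
  rw [weightedKernel, norm_mul, norm_mul, Complex.norm_real, Complex.norm_real,
    Real.norm_of_nonneg (by positivity), Real.norm_of_nonneg (by positivity)]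

/-- Allows boundary points `(g.w₀, w₀)` to be moved to the diagonal. -/
theorem norm_weightedKernel_apply [Finite G] {e : Submodule ℂ (Cn 2) → Cn 2}
    (he : IsRootChoice G e) (hE : IsBoundedInvariantDomain G E) (p : ℝ) {g : UnitaryMap 2}
    (hg : g ∈ G) {z w : Cn 2} (hz : z ∈ E) (hw : w ∈ E) :
    ‖weightedKernel E G e p (g z) w‖ = ‖weightedKernel E G e p z w‖ := by
  have hfin : (G : Set (UnitaryMap 2)).Finite := Set.toFinite _
  have hT : ∀ x, x ∈ hfin.toFinset ↔ x ∈ G := fun x => hfin.mem_toFinset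
  have h1 := det_mul_partialKernel_left hE (T := hfin.toFinset) (fun x hx => (hT x).1 hx) hg
    (fun x => by rw [hT, hT]; exact G.mul_mem_cancel_left hg) hz hw
  have h2 := congrArg norm h1
  rw [norm_mul, g.norm_det, one_mul] at h2
  rw [norm_weightedKernel, norm_weightedKernel, norm_jacobianPoly_apply he hg,
    averagedKernel_eq_partialKernel hT, averagedKernel_eq_partialKernel hT, norm_mul, norm_mul, h2]

/-- One factor `x` compensates a weight of exponent greater than `-1`; at `x = 0` the product
vanishes whatever value `0 ^ a` takes. -/
theorem rpow_mul_self_le {x B a : ℝ} (hx : 0 ≤ x) (hxB : x ≤ B) (hB : 1 ≤ B) (ha : -1 < a) :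
    x ^ a * x ≤ B ^ (a + 1) := by
  rcases hx.eq_or_lt with rfl | hx0
  · rw [mul_zero]; positivity
  · rw [← Real.rpow_add_one hx0.ne']
    exact Real.rpow_le_rpow hx hxB (by linarith)

/-- Used with `x = |J_G(z)|`, `y = |J_G(w)|` and `a = 2 / p - 1`; the condition `|a| < 1` is exactly
`1 < p < ∞`. -/
theorem weight_mul_le {x y B C k a : ℝ} (hx : 0 ≤ x) (hy : 0 ≤ y) (hxB : x ≤ B) (hyB : y ≤ B)
    (hB : 1 ≤ B) (ha : -1 < a) (ha' : a < 1) (hC : 0 ≤ C) (hk : k ≤ C * (x * y)) :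
    x ^ a * k * y ^ (-a) ≤ C * (B ^ (a + 1) * B ^ (-a + 1)) := by
  have h1 := rpow_mul_self_le hx hxB hB ha
  have h2 := rpow_mul_self_le (a := -a) hy hyB hB (by linarith)
  calc x ^ a * k * y ^ (-a) ≤ x ^ a * (C * (x * y)) * y ^ (-a) := by gcongr
    _ = C * ((x ^ a * x) * (y ^ (-a) * y)) := by ring
    _ ≤ _ := by gcongr

theorem exists_norm_jacobianPoly_le [Finite G] (e : Submodule ℂ (Cn 2) → Cn 2)
    (hb : Bornology.IsBounded E) : ∃ B : ℝ, 1 ≤ B ∧ ∀ z ∈ E, ‖jacobianPoly G e z‖ ≤ B := by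
  obtain ⟨B, hB⟩ := hb.isCompact_closure.exists_bound_of_continuousOn
    (continuous_jacobianPoly (G := G) e).continuousOn
  exact ⟨max 1 B, le_max_left _ _, fun z hz => (hB z (subset_closure hz)).trans (le_max_right _ _)⟩

theorem exists_norm_weightedKernel_le_of_partialKernel [Finite G]
    {e : Submodule ℂ (Cn 2) → Cn 2} (he : IsRootChoice G e) (hE : IsBoundedInvariantDomain G E)
    (h0 : (0 : Cn 2) ∈ E)
    (hK : ∀ q ∈ frontier (doubledDomain E), q.1 ≠ conjVec q.2 →
      ContinuesPast (doubledDomain E) (holoBergmanKernel E) q)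
    {a : ℝ} (ha : -1 < a) (ha' : a < 1)
    {T : Finset (UnitaryMap 2)} (hTG : ∀ g ∈ T, g ∈ G)
    {z₀ w₀ : Cn 2} (hz₀ : z₀ ∈ closure E) (hw₀ : w₀ ∈ closure E)
    (hext : ∀ g ∈ T, z₀ ≠ g w₀ ∨ z₀ ∈ E)
    (hleft : ∀ Y ∈ reflectingHyperplanes G, z₀ ∈ Y → ∀ r ∈ pointwiseFixer G Y,
      ∀ g, r * g ∈ T ↔ g ∈ T)
    (hright : ∀ Y ∈ reflectingHyperplanes G, w₀ ∈ Y → ∀ r ∈ pointwiseFixer G Y,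
      ∀ g, g * r ∈ T ↔ g ∈ T) :
    ∃ ε > 0, ∃ C : ℝ, 0 ≤ C ∧ ∀ z ∈ E ∩ ball z₀ ε, ∀ w ∈ E ∩ ball w₀ ε,
      ‖jacobianPoly G e z‖ ^ a * ‖partialKernel E T z w‖ * ‖jacobianPoly G e w‖ ^ (-a) ≤ C := by
  obtain ⟨B, hB, hJB⟩ := exists_norm_jacobianPoly_le (G := G) e hE.isBounded
  obtain ⟨ε, hε, C, hC, h⟩ := exists_norm_partialKernel_le he hE h0 hK hTG hz₀ hw₀ hext hleft hright
  refine ⟨ε, hε, C * (B ^ (a + 1) * B ^ (-a + 1)), by positivity, fun z hz w hw => ?_⟩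
  exact weight_mul_le (norm_nonneg _) (norm_nonneg _) (hJB z hz.1) (hJB w hw.1) hB ha ha' hC
    (h z hz w hw)

theorem one_div_card_le_one (G : Subgroup (UnitaryMap 2)) [Finite G] :
    ‖(1 / (Nat.card G : ℂ))‖ ≤ 1 := by
  have h : (1 : ℝ) ≤ Nat.card G := by exact_mod_cast Nat.card_pos (α := G)
  rw [norm_div, norm_one, Complex.norm_natCast, div_le_one (by linarith)]
  exact h

/-- Away from the boundary part of the `G`-orbit of the diagonal, the weighted kernel is bounded. -/
theorem exists_norm_weightedKernel_le [Finite G]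
    {e : Submodule ℂ (Cn 2) → Cn 2} (he : IsRootChoice G e) (hE : IsBoundedInvariantDomain G E)
    (h0 : (0 : Cn 2) ∈ E)
    (hK : ∀ q ∈ frontier (doubledDomain E), q.1 ≠ conjVec q.2 →
      ContinuesPast (doubledDomain E) (holoBergmanKernel E) q)
    {p : ℝ} (hp : 1 < p) {z₀ w₀ : Cn 2} (hz₀ : z₀ ∈ closure E) (hw₀ : w₀ ∈ closure E)
    (hext : ∀ g ∈ G, z₀ ≠ g w₀ ∨ z₀ ∈ E) :
    ∃ ε > 0, ∃ C : ℝ, 0 ≤ C ∧ ∀ z ∈ E ∩ ball z₀ ε, ∀ w ∈ E ∩ ball w₀ ε,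
      ‖weightedKernel E G e p z w‖ ≤ C := by
  have hfin : (G : Set (UnitaryMap 2)).Finite := Set.toFinite _
  have hT : ∀ x, x ∈ hfin.toFinset ↔ x ∈ G := fun x => hfin.mem_toFinset
  have hp2 : 0 < 2 / p ∧ 2 / p < 2 := ⟨by positivity, by rw [div_lt_iff₀ (by linarith)]; linarith⟩
  obtain ⟨ε, hε, C, hC, h⟩ := exists_norm_weightedKernel_le_of_partialKernel he hE h0 hK
    (a := 2 / p - 1) (by linarith) (by linarith) (T := hfin.toFinset) (fun x hx => (hT x).1 hx)
    hz₀ hw₀ (fun g hg => hext g ((hT g).1 hg))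
    (fun Y _ _ r hr g => by rw [hT, hT]; exact G.mul_mem_cancel_left hr.1)
    (fun Y _ _ r hr g => by rw [hT, hT]; exact G.mul_mem_cancel_right hr.1)
  refine ⟨ε, hε, C, hC, fun z hz w hw => ?_⟩
  have h1 := h z hz w hw
  rw [neg_sub] at h1
  rw [norm_weightedKernel, averagedKernel_eq_partialKernel hT, norm_mul]
  refine le_trans ?_ h1
  gcongr
  exact mul_le_of_le_one_left (norm_nonneg _) (one_div_card_le_one G)

/-- Near a nonzero point all of whose reflecting lines belong to `S`, the Jacobians of `G` and of
`G_S` agree up to a positive continuous factor. -/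
theorem exists_norm_jacobianPoly_eq_mul_generated [Finite G] {S : Set (Submodule ℂ (Cn 2))}
    [Finite (generatedSubgroup G S)]
    (hS : S = reflectingHyperplanes (generatedSubgroup G S)) {e e' : Submodule ℂ (Cn 2) → Cn 2}
    (he : IsRootChoice G e) (he' : IsRootChoice (generatedSubgroup G S) e') {w₀ : Cn 2}
    (hw₀ : ∀ Y ∈ reflectingHyperplanes G, w₀ ∈ Y → Y ∈ S) :
    ∃ q : Cn 2 → ℝ, Continuous q ∧ 0 < q w₀ ∧ (∀ z, 0 ≤ q z) ∧
      ∀ z, ‖jacobianPoly G e z‖ = ‖jacobianPoly (generatedSubgroup G S) e' z‖ * q z := by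
  classical
  set T := (finite_reflectingHyperplanes G).toFinset with hTdef
  set T' := (finite_reflectingHyperplanes (generatedSubgroup G S)).toFinset with hTdef'
  have hT' : ∀ Y, Y ∈ T' ↔ Y ∈ S := fun Y => by
    rw [Set.Finite.mem_toFinset, ← hS]
  have hT : ∀ Y, Y ∈ T ↔ Y ∈ reflectingHyperplanes G := fun Y => Set.Finite.mem_toFinset _
  have hsub : T' ⊆ T := by
    intro Y hY
    rw [Set.Finite.mem_toFinset] at hY ⊢
    obtain ⟨r, hr, hrefl, rfl⟩ := hY
    exact ⟨r, generatedSubgroup_le G S hr, hrefl, rfl⟩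
  refine ⟨fun z => ∏ X ∈ T \ T', ‖(inner ℂ (e X) z : ℂ)‖ ^ (reflMultiplicity G X - 1),
    by fun_prop, ?_, fun z => by positivity, fun z => ?_⟩
  · refine Finset.prod_pos fun X hX => pow_pos (norm_pos_iff.2 fun h => ?_) _
    obtain ⟨hXT, hXT'⟩ := Finset.mem_sdiff.1 hX
    have hXR := (hT X).1 hXT
    exact hXT' ((hT' X).2 (hw₀ X hXR ((mem_iff_inner_eq_zero
      (finrank_of_mem_reflectingHyperplanes hXR) (he X hXR).1 (he X hXR).2).2 h)))
  · rw [norm_jacobianPoly, norm_jacobianPoly, ← Finset.prod_sdiff hsub, mul_comm]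
    congr 1
    refine Finset.prod_congr rfl fun Y hY => ?_
    have hYS := (hT' Y).1 hY
    have hYR := (hT Y).1 (hsub hY)
    have hYR' : Y ∈ reflectingHyperplanes (generatedSubgroup G S) := hS ▸ hYS
    rw [reflMultiplicity, reflMultiplicity, pointwiseFixer_generatedSubgroup hYS,
      norm_inner_eq_of_orthogonal (finrank_of_mem_reflectingHyperplanes hYR) (he' Y hYR').1
        (he' Y hYR').2 (he Y hYR).1 (he Y hYR).2]

/-- Near a boundary point of the diagonal all of whose reflecting lines belong to `S`, the weighted
kernel of `G` is dominated by that of `G_S`. -/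
theorem exists_norm_weightedKernel_le_generated [Finite G]
    {e e' : Submodule ℂ (Cn 2) → Cn 2} (he : IsRootChoice G e)
    (hE : IsBoundedInvariantDomain G E) (h0 : (0 : Cn 2) ∈ E)
    (hK : ∀ q ∈ frontier (doubledDomain E), q.1 ≠ conjVec q.2 →
      ContinuesPast (doubledDomain E) (holoBergmanKernel E) q)
    {S : Set (Submodule ℂ (Cn 2))} (hS : S = reflectingHyperplanes (generatedSubgroup G S))
    (he' : IsRootChoice (generatedSubgroup G S) e')
    {p : ℝ} (hp : 1 < p) {w₀ : Cn 2} (hw₀ : w₀ ∈ closure E) (hw0 : w₀ ≠ 0)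
    (hwS : ∀ Y ∈ reflectingHyperplanes G, w₀ ∈ Y → Y ∈ S) :
    ∃ ε > 0, ∃ C : ℝ, 0 ≤ C ∧ ∀ z ∈ E ∩ ball w₀ ε, ∀ w ∈ E ∩ ball w₀ ε,
      ‖weightedKernel E G e p z w‖ ≤
        C * (‖weightedKernel E (generatedSubgroup G S) e' p z w‖ + 1) := by
  classical
  set H := generatedSubgroup G S with hH
  have hHG : H ≤ G := generatedSubgroup_le G S
  have hHfin : Finite H := Finite.of_injective _ (Subgroup.inclusion_injective hHG)
  have hfin : (G : Set (UnitaryMap 2)).Finite := Set.toFinite _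
  have hfin' : (H : Set (UnitaryMap 2)).Finite := Set.toFinite _
  set TG := hfin.toFinset with hTGdef
  set TH := hfin'.toFinset with hTHdef
  have hTG : ∀ x, x ∈ TG ↔ x ∈ G := fun x => hfin.mem_toFinset
  have hTH : ∀ x, x ∈ TH ↔ x ∈ H := fun x => hfin'.mem_toFinset
  have hsub : TH ⊆ TG := fun x hx => (hTG x).2 (hHG ((hTH x).1 hx))
  have hT : ∀ x, x ∈ TG \ TH ↔ x ∈ G ∧ x ∉ H := fun x => by
    rw [Finset.mem_sdiff, hTG, hTH]
  have hYH : ∀ Y ∈ reflectingHyperplanes G, w₀ ∈ Y → ∀ r ∈ pointwiseFixer G Y, r ∈ H :=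
    fun Y hY hwY r hr => by
      rw [← pointwiseFixer_generatedSubgroup (hwS Y hY hwY)] at hr
      exact hr.1
  have hp2 : 0 < 2 / p ∧ 2 / p < 2 := ⟨by positivity, by rw [div_lt_iff₀ (by linarith)]; linarith⟩
  set a := 2 / p - 1 with ha
  obtain ⟨ε₁, hε₁, C, hC, h⟩ := exists_norm_weightedKernel_le_of_partialKernel he hE h0 hK
    (a := a) (by linarith) (by linarith) (T := TG \ TH) (fun x hx => ((hT x).1 hx).1)
    -- An element `g ≠ 1` fixing `w₀` is a reflection whose line passes through `w₀`. That line
    -- belongs to `S`, so `g` would lie in `H`.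
    hw₀ hw₀ (fun g hg => by
      left
      intro hfix
      obtain ⟨hgG, hgH⟩ := (hT g).1 hg
      have hg1 : g ≠ 1 := by rintro rfl; exact hgH H.one_mem
      have hord : IsOfFinOrder g :=
        G.subtype.isOfFinOrder (isOfFinOrder_of_finite (⟨g, hgG⟩ : G))
      have hrefl := isReflection_of_apply_eq hord hg1 hw0 hfix.symm
      exact hgH (hYH (fixedSpace g) ⟨g, hgG, hrefl, rfl⟩ hfix.symm g ⟨hgG, fun v hv => hv⟩))
    -- The reflections fixing `w₀` lie in `H`, and the complement of a subgroup is stable under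
    -- multiplication by it on either side.
    (fun Y hY hwY r hr g => by
      rw [hT, hT, G.mul_mem_cancel_left hr.1, H.mul_mem_cancel_left (hYH Y hY hwY r hr)])
    (fun Y hY hwY r hr g => by
      rw [hT, hT, G.mul_mem_cancel_right hr.1, H.mul_mem_cancel_right (hYH Y hY hwY r hr)])
  obtain ⟨q, hq, hq0, hqn, hJ⟩ := exists_norm_jacobianPoly_eq_mul_generated hS he he' hwS
  -- Positivity of `q` at `w₀` bounds both powers `q ^ a` and `q ^ (-a)` nearby, whatever the sign
  -- of `a`.
  have hev : ∀ b : ℝ, ∀ᶠ z in 𝓝 w₀, q z ^ b < q w₀ ^ b + 1 := fun b =>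
    (hq.continuousAt.rpow_const (Or.inl hq0.ne')).eventually (gt_mem_nhds (lt_add_one _))
  obtain ⟨ε₂, hε₂, hball⟩ := Metric.eventually_nhds_iff_ball.1 ((hev a).and (hev (-a)))
  have hA : 0 ≤ (q w₀ ^ a + 1) * (q w₀ ^ (-a) + 1) := by positivity
  refine ⟨min ε₁ ε₂, lt_min hε₁ hε₂, C + (q w₀ ^ a + 1) * (q w₀ ^ (-a) + 1), by positivity, ?_⟩
  rintro z ⟨hzE, hz⟩ w ⟨hwE, hw⟩
  have h1 := h z ⟨hzE, ball_subset_ball (min_le_left _ _) hz⟩ w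
    ⟨hwE, ball_subset_ball (min_le_left _ _) hw⟩
  have hqz := (hball z (ball_subset_ball (min_le_right _ _) hz)).1
  have hqw := (hball w (ball_subset_ball (min_le_right _ _) hw)).2
  have ha2 : 1 - 2 / p = -a := by rw [ha]; ring
  have hcard : (Nat.card H : ℂ) ≠ 0 := by exact_mod_cast Nat.card_pos.ne'
  have hsplit : partialKernel E TG z w =
      partialKernel E (TG \ TH) z w + (Nat.card H : ℂ) * averagedKernel E H z w := by
    rw [averagedKernel_eq_partialKernel hTH, ← mul_assoc, mul_one_div_cancel hcard, one_mul]
    exact (Finset.sum_sdiff hsub).symm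
  have hcardG : (0 : ℝ) < Nat.card G := by exact_mod_cast Nat.card_pos (α := G)
  have hcardle : ‖(1 / (Nat.card G : ℂ))‖ * (Nat.card H : ℝ) ≤ 1 := by
    rw [norm_div, norm_one, Complex.norm_natCast, div_mul_eq_mul_div, one_mul,
      div_le_one hcardG]
    exact_mod_cast Nat.card_le_card_of_injective _ (Subgroup.inclusion_injective hHG)
  have havg : ‖averagedKernel E G z w‖ ≤
      ‖partialKernel E (TG \ TH) z w‖ + ‖averagedKernel E H z w‖ := by
    rw [averagedKernel_eq_partialKernel hTG, hsplit, mul_add]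
    refine (norm_add_le _ _).trans (add_le_add ?_ ?_)
    · rw [norm_mul]
      exact mul_le_of_le_one_left (norm_nonneg _) (one_div_card_le_one G)
    · rw [norm_mul, norm_mul, Complex.norm_natCast, ← mul_assoc]
      exact mul_le_of_le_one_left (norm_nonneg _) hcardle
  rw [norm_weightedKernel, norm_weightedKernel, ha2, ← ha]
  set Jz := ‖jacobianPoly G e z‖
  set Jw := ‖jacobianPoly G e w‖
  set jz := ‖jacobianPoly H e' z‖
  set jw := ‖jacobianPoly H e' w‖
  set k := ‖averagedKernel E H z w‖
  have hJz : Jz ^ a = jz ^ a * q z ^ a := by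
    rw [show Jz = jz * q z from hJ z, Real.mul_rpow (norm_nonneg _) (hqn z)]
  have hJw : Jw ^ (-a) = jw ^ (-a) * q w ^ (-a) := by
    rw [show Jw = jw * q w from hJ w, Real.mul_rpow (norm_nonneg _) (hqn w)]
  have hqzn : 0 ≤ q z ^ a := Real.rpow_nonneg (hqn z) _
  have hqwn : 0 ≤ q w ^ (-a) := Real.rpow_nonneg (hqn w) _
  have hkn : 0 ≤ jz ^ a * k * jw ^ (-a) := by positivity
  calc Jz ^ a * ‖averagedKernel E G z w‖ * Jw ^ (-a)
      ≤ Jz ^ a * (‖partialKernel E (TG \ TH) z w‖ + k) * Jw ^ (-a) := by gcongr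
    _ = Jz ^ a * ‖partialKernel E (TG \ TH) z w‖ * Jw ^ (-a) +
        (q z ^ a * q w ^ (-a)) * (jz ^ a * k * jw ^ (-a)) := by
          rw [mul_add, add_mul]
          congr 1
          rw [hJz, hJw]; ring
    _ ≤ C + ((q w₀ ^ a + 1) * (q w₀ ^ (-a) + 1)) * (jz ^ a * k * jw ^ (-a)) := by gcongr
    _ ≤ _ := by nlinarith [mul_nonneg hC hkn]

/-! ### Compactness and conclusion -/

theorem le_card_mul_average [Finite G] {k : UnitaryMap 2 → ℝ} (hk : ∀ g, 0 ≤ k g)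
    {g : UnitaryMap 2} (hg : g ∈ G) :
    k g ≤ Nat.card G * ((1 / (Nat.card G : ℝ)) * ∑ᶠ g : G, k g) := by
  have := Fintype.ofFinite G
  have hcard : (0 : ℝ) < Nat.card G := by exact_mod_cast Nat.card_pos (α := G)
  rw [← mul_assoc, mul_one_div_cancel hcard.ne', one_mul, finsum_eq_sum_of_fintype]
  exact Finset.single_le_sum (f := fun g : G => k g) (fun g _ => hk g)
    (Finset.mem_univ (⟨g, hg⟩ : G))

/-- Patches local bounds by compactness. The predicate `P` confines the inequality to points of `E ×
E`, while the neighbourhoods are centred at points of the closure. -/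
theorem exists_global_bound {X : Type*} [TopologicalSpace X] {K : Set X} (hK : IsCompact K)
    {P : X → Prop} {f g : X → ℝ} (hg : ∀ x, 0 ≤ g x)
    (h : ∀ x ∈ K, ∃ U ∈ 𝓝 x, ∃ C : ℝ, 0 ≤ C ∧ ∀ y ∈ U, P y → f y ≤ C * g y) :
    ∃ C : ℝ, 0 ≤ C ∧ ∀ y ∈ K, P y → f y ≤ C * g y := by
  refine hK.induction_on (p := fun s => ∃ C : ℝ, 0 ≤ C ∧ ∀ y ∈ s, P y → f y ≤ C * g y)
    ⟨0, le_rfl, by simp⟩ ?_ ?_ ?_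
  · rintro s t hst ⟨C, hC, hCt⟩
    exact ⟨C, hC, fun y hy => hCt y (hst hy)⟩
  · rintro s t ⟨C, hC, hCs⟩ ⟨D, hD, hDt⟩
    refine ⟨max C D, le_max_of_le_left hC, ?_⟩
    rintro y (hy | hy) hP
    · exact (hCs y hy hP).trans (mul_le_mul_of_nonneg_right (le_max_left _ _) (hg y))
    · exact (hDt y hy hP).trans (mul_le_mul_of_nonneg_right (le_max_right _ _) (hg y))
  · intro x hx
    obtain ⟨U, hU, h'⟩ := h x hx
    exact ⟨U, mem_nhdsWithin_of_mem_nhds hU, h'⟩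

end ReflBergman

open ReflBergman
theorem theorem1p12
    (G : Subgroup (UnitaryMap 2)) (hG : IsReflectionGroup G)
    (E : Set (Cn 2)) (hE : IsBoundedInvariantDomain G E) (hgood : IsGood G E)
    (h0 : (0 : Cn 2) ∈ E)
    (hK : ∀ q ∈ frontier (doubledDomain E), q.1 ≠ conjVec q.2 →
      ContinuesPast (doubledDomain E) (holoBergmanKernel E) q)
    (S₁ S₂ : Set (Submodule ℂ (Cn 2)))
    (hS₁ : IsInvariantFamily G S₁) (hS₂ : IsInvariantFamily G S₂)
    (hunion : reflectingHyperplanes G = S₁ ∪ S₂) (hdisj : S₁ ∩ S₂ = ∅)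
    (hGS₁ : S₁ = reflectingHyperplanes (generatedSubgroup G S₁))
    (hGS₂ : S₂ = reflectingHyperplanes (generatedSubgroup G S₂))
    (e e₁ e₂ : Submodule ℂ (Cn 2) → Cn 2) (he : IsRootChoice G e)
    (he₁ : IsRootChoice (generatedSubgroup G S₁) e₁) (he₂ : IsRootChoice (generatedSubgroup G S₂) e₂)
    (p : ℝ) (hp : 1 < p) :
    ∃ C : ℝ, 0 < C ∧ ∀ z ∈ E, ∀ w ∈ E,
      ‖weightedKernel E G e p z w‖ ≤
        C * ((1 / (Nat.card G : ℝ)) * ∑ᶠ g : G,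
          (‖weightedKernel E (generatedSubgroup G S₁) e₁ p ((g : UnitaryMap 2) z) w‖ +
            ‖weightedKernel E (generatedSubgroup G S₂) e₂ p ((g : UnitaryMap 2) z) w‖ + 1)) := by
  have hfin : Finite G := hG.1
  have hcard : (0 : ℝ) < Nat.card G := by exact_mod_cast Nat.card_pos (α := G)
  let k₁ : Cn 2 → Cn 2 → ℝ := fun z w => ‖weightedKernel E (generatedSubgroup G S₁) e₁ p z w‖
  let k₂ : Cn 2 → Cn 2 → ℝ := fun z w => ‖weightedKernel E (generatedSubgroup G S₂) e₂ p z w‖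
  let s : Cn 2 × Cn 2 → ℝ := fun x => (1 / (Nat.card G : ℝ)) * ∑ᶠ g : G,
    (k₁ ((g : UnitaryMap 2) x.1) x.2 + k₂ ((g : UnitaryMap 2) x.1) x.2 + 1)
  have hk₁ : ∀ z w, 0 ≤ k₁ z w := fun z w => norm_nonneg _
  have hk₂ : ∀ z w, 0 ≤ k₂ z w := fun z w => norm_nonneg _
  have hterm : ∀ x : Cn 2 × Cn 2, ∀ g ∈ G,
      k₁ (g x.1) x.2 + k₂ (g x.1) x.2 + 1 ≤ Nat.card G * s x := by
    intro x g hg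
    exact le_card_mul_average (k := fun g => k₁ (g x.1) x.2 + k₂ (g x.1) x.2 + 1)
      (fun g => add_nonneg (add_nonneg (hk₁ _ _) (hk₂ _ _)) zero_le_one) hg
  have hs : ∀ x, 0 ≤ s x := by
    intro x
    have h1 := hterm x 1 G.one_mem
    have h2 := hk₁ ((1 : UnitaryMap 2) x.1) x.2
    have h3 := hk₂ ((1 : UnitaryMap 2) x.1) x.2
    by_contra hneg
    push Not at hneg
    nlinarith
  have hcl : IsCompact (closure E ×ˢ closure E) :=
    hE.isBounded.isCompact_closure.prod hE.isBounded.isCompact_closure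
  obtain ⟨C, hC, hbound⟩ := exists_global_bound hcl (P := fun x => x.1 ∈ E ∧ x.2 ∈ E)
    (f := fun x => ‖weightedKernel E G e p x.1 x.2‖) hs (by
    rintro ⟨z₀, w₀⟩ ⟨hz₀, hw₀⟩
    simp only at hz₀ hw₀
    -- When this fails, `z₀ = g w₀` is a boundary point of `E`, the only place where a term can be
    -- singular.
    by_cases hcase : ∀ g ∈ G, z₀ ≠ g w₀ ∨ z₀ ∈ E
    · obtain ⟨ε, hε, C, hC, h⟩ := exists_norm_weightedKernel_le he hE h0 hK hp hz₀ hw₀ hcase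
      refine ⟨ball z₀ ε ×ˢ ball w₀ ε, prod_mem_nhds (ball_mem_nhds _ hε) (ball_mem_nhds _ hε),
        C * Nat.card G, by positivity, ?_⟩
      rintro ⟨z, w⟩ ⟨hz, hw⟩ ⟨hzE, hwE⟩
      have h1 := hterm (z, w) 1 G.one_mem
      have h2 : 1 ≤ Nat.card G * s (z, w) := by
        have h2 := hk₁ ((1 : UnitaryMap 2) z) w
        have h3 := hk₂ ((1 : UnitaryMap 2) z) w
        simp only at h1
        linarith
      calc ‖weightedKernel E G e p z w‖ ≤ C * 1 := by
            rw [mul_one]; exact h z ⟨hzE, hz⟩ w ⟨hwE, hw⟩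
        _ ≤ C * (Nat.card G * s (z, w)) := by gcongr
        _ = _ := by ring
    · push Not at hcase
      obtain ⟨g, hg, rfl, hgE⟩ := hcase
      have hw₀E : w₀ ∉ E := fun h => hgE (hE.invariant g hg w₀ h)
      have hw0 : w₀ ≠ 0 := by rintro rfl; exact hw₀E h0
      have hdiag : ∃ ε > 0, ∃ C : ℝ, 0 ≤ C ∧ ∀ z ∈ E ∩ ball w₀ ε, ∀ w ∈ E ∩ ball w₀ ε,
          ‖weightedKernel E G e p z w‖ ≤ C * (k₁ z w + k₂ z w + 1) := by
        -- Since `w₀ ≠ 0`, at most one reflecting line passes through `w₀`. If there is none, this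
        -- condition holds vacuously and `S₁` serves.
        by_cases hw₁ : ∀ Y ∈ reflectingHyperplanes G, w₀ ∈ Y → Y ∈ S₁
        · obtain ⟨ε, hε, C, hC, h⟩ := exists_norm_weightedKernel_le_generated he hE h0 hK hGS₁ he₁
            hp hw₀ hw0 hw₁
          refine ⟨ε, hε, C, hC, fun z hz w hw => (h z hz w hw).trans ?_⟩
          gcongr
          exact le_add_of_nonneg_right (hk₂ z w)
        · push Not at hw₁
          obtain ⟨Y, hY, hwY, hYS⟩ := hw₁
          have hw₂ : ∀ X ∈ reflectingHyperplanes G, w₀ ∈ X → X ∈ S₂ := by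
            intro X hX hwX
            have hXY : X = Y := by
              rw [eq_span_singleton (finrank_of_mem_reflectingHyperplanes hX) hwX hw0,
                eq_span_singleton (finrank_of_mem_reflectingHyperplanes hY) hwY hw0]
            rw [hXY]
            rw [hunion] at hY
            exact hY.resolve_left hYS
          obtain ⟨ε, hε, C, hC, h⟩ := exists_norm_weightedKernel_le_generated he hE h0 hK hGS₂ he₂
            hp hw₀ hw0 hw₂
          refine ⟨ε, hε, C, hC, fun z hz w hw => (h z hz w hw).trans ?_⟩
          gcongr
          exact le_add_of_nonneg_left (hk₁ z w)
      obtain ⟨ε, hε, C, hC, h⟩ := hdiag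
      refine ⟨ball (g w₀) ε ×ˢ ball w₀ ε, prod_mem_nhds (ball_mem_nhds _ hε) (ball_mem_nhds _ hε),
        C * Nat.card G, by positivity, ?_⟩
      rintro ⟨z, w⟩ ⟨hz, hw⟩ ⟨hzE, hwE⟩
      have hg' := G.inv_mem hg
      have hz' : g⁻¹ z ∈ ball w₀ ε := by
        have h1 : dist (g⁻¹ z) w₀ = dist z (g w₀) := by
          rw [← g.dist_map, LinearIsometryEquiv.coe_inv, g.apply_symm_apply]
        rw [mem_ball, h1]; exact hz
      simp only at hzE hwE ⊢
      -- Replacing `z` by `g⁻¹ z` on the left brings in the subgroup kernels at `g⁻¹ z`, which form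
      -- one term of the average over `G`.
      rw [← norm_weightedKernel_apply he hE p hg' hzE hwE]
      calc ‖weightedKernel E G e p (g⁻¹ z) w‖
          ≤ C * (k₁ (g⁻¹ z) w + k₂ (g⁻¹ z) w + 1) :=
            h _ ⟨hE.invariant _ hg' z hzE, hz'⟩ w ⟨hwE, hw⟩
        _ ≤ C * (Nat.card G * s (z, w)) := by
            gcongr
            exact hterm (z, w) _ hg'
        _ = _ := by ring)
  refine ⟨C + 1, by positivity, fun z hz w hw => ?_⟩
  refine (hbound (z, w) ⟨subset_closure hz, subset_closure hw⟩ ⟨hz, hw⟩).trans ?_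
  exact mul_le_mul_of_nonneg_right (by linarith) (hs (z, w))
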